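/- Let $d\ge 1$ and $n\ge 1$ be integers and let $\lambda^-<\lambda^+$ be real numbers. Put $\mathbb Z^d_{n,+}=\{x\in\mathbb Z^d: x_1\ge n\}$, $\mathbb Z^d_{-n,-}=\{x\in\mathbb Z^d: x_1\le -n\}$, $C_n=\{x\in\mathbb Z^d: |x_i|\le n \text{ for all } i\}$ and $\mathcal C=\mathbb Z^d_{n,+}\cup C_n\cup\mathbb Z^d_{-n,-}$. For $N\in\mathbb N$ let $\Lambda_{n,N}=\mathcal C\cap[-N,N]^d$ and $S_{n,N}=\Lambda_{n,N+1}\setminus\Lambda_{n,N}$. Write $x\sim y$ for nearest neighbours. Let $X$ be the continuous-time random walk on $\mathcal C$ that jumps at rate $1$ to each nearest neighbour in $\mathcal C$, let $\mathbb P_x$ be its law when started from $x$, and for $x\in\mathcal C$ define $$\lambda_x=\lambda^-p_x^-+\lambda^+p_x^+,\qquad p_x^\pm=\mathbb P_x\big(\exists\, T\in(0,\infty):\ X(t)\in\mathbb Z^d_{\pm n,\pm}\ \text{for all } t\ge T\big).$$ For $\Delta\subseteq S_{n,N}$ let $X^{N,\Delta}$ be the continuous-time random walk on $\Lambda_{n,N}\cup\Delta$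 that jumps at rate $1$ from each $x\in\Lambda_{n,N}$ to each of its nearest neighbours in $\Lambda_{n,N}\cup\Delta$ and is absorbed in $\Delta$; its generator is $G^{N,\Delta}\psi(x)=\sum_{y\in\Lambda_{n,N}\cup\Delta,\,y\sim x}[\psi(y)-\psi(x)]$ for $x\in\Lambda_{n,N}$ and $G^{N,\Delta}\psi(x)=0$ for $x\in\Delta$. Let $\tau\in[0,\infty]$ be the hitting time of $\Delta$. For $\sigma:\Delta\to\mathbb R$ and $x\in\Lambda_{n,N}\cup\Delta$ define $$\lambda^{(N,\Delta,\sigma)}_x=\sum_{y\in\Delta}\sigma_y\,\mathbb P_x\big(\tau<\infty,\ X^{N,\Delta}(\tau)=y\big).$$ Then the following hold. 1. For every $N\in\mathbb N$, $\Delta\subseteq S_{n,N}$ and $\sigma:\Delta\to\mathbb R$, the function $\lambda^{(N,\Delta,\sigma)}$ is harmonic with boundary condition $\sigma$: $G^{N,\Delta}\lambda^{(N,\Delta,\sigma)}(x)=0$ for all $x\in\Lambda_{n,N}\cup\Delta$, and $\lambda^{(N,\Delta,\sigma)}_x=\sigma_x$ for all $x\in\Delta$. 2. (Fick setting.) Suppose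 $d\ge 3$. For $N>n$ let $\Delta_\pm=\{y\in S_{n,N}: y\mp e_1\in\Lambda_{n,N}\}$, where $e_1$ is the first unit vector, let $\Delta=\Delta_+\cup\Delta_-$, and let $\sigma=\lambda^+$ on $\Delta_+$ and $\sigma=\lambda^-$ on $\Delta_-$. Then $\lim_{N\to\infty}\lambda^{(N,\Delta,\sigma)}_x=\lambda_x$ for every $x\in\mathcal C$. 3. (Full setting.) Let $N\in\mathbb N$, $\Delta=S_{n,N}$ and $\sigma_x=\lambda_x$ for $x\in\Delta$. Then $\lambda^{(N,\Delta,\sigma)}_x=\lambda_x$ for all $x\in\Lambda_{n,N}$. -/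

import Mathlib

open MeasureTheory ProbabilityTheory Filter Topology
open scoped ENNReal NNReal

namespace FickWalk

/-! ## Continuous-time random walks that jump at rate `1` to each neighbour -/

section Walk

variable {V : Type*}

/-- The generator `Gψ(x) = ∑_{y ∈ nbr x} (ψ(y) - ψ(x))` of the walk that jumps at rate `1` from `x`
to each site of the finite set `nbr x`; it vanishes at `x` if `nbr x = ∅`. -/
def generator (nbr : V → Finset V) (ψ : V → ℝ) (x : V) : ℝ :=
  ∑ y ∈ nbr x, (ψ y - ψ x)

variable [MeasurableSpace V] [MeasurableSingletonClass V] [Countable V]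

open Classical in
/-- One step of the embedded jump chain: uniform on `nbr v`; the walk stays at `v` if `nbr v` is
empty. -/
noncomputable def stepMeasure (nbr : V → Finset V) (v : V) : Measure V :=
  if h : (nbr v).Nonempty then (PMF.uniformOfFinset (nbr v) h).toMeasure else Measure.dirac v

instance stepMeasure_isProbabilityMeasure (nbr : V → Finset V) (v : V) :
    IsProbabilityMeasure (stepMeasure nbr v) := by
  unfold stepMeasure
  split_ifs <;> infer_instance

/-- The transition kernel of the embedded jump chain. -/
noncomputable def stepKernel (nbr : V → Finset V) : Kernel V V :=
  Kernel.ofFunOfCountable (stepMeasure nbr)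

instance stepKernel_isMarkovKernel (nbr : V → Finset V) : IsMarkovKernel (stepKernel nbr) :=
  ⟨fun v => stepMeasure_isProbabilityMeasure nbr v⟩

/-- The transition kernel of the embedded jump chain, as a kernel from histories up to time `k`:
it depends on the last state only. -/
noncomputable def historyKernel (nbr : V → Finset V) (k : ℕ) :
    Kernel ((_i : Finset.Iic k) → V) V :=
  (stepKernel nbr).comap (fun h => h ⟨k, Finset.mem_Iic.2 le_rfl⟩) (measurable_pi_apply _)

instance historyKernel_isMarkovKernel (nbr : V → Finset V) (k : ℕ) :
    IsMarkovKernel (historyKernel nbr k) := by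
  unfold historyKernel
  infer_instance

/-- The law on `ℕ → V` of the embedded jump chain started from `x`. -/
noncomputable def chainLaw (nbr : V → Finset V) (x : V) : Measure (ℕ → V) :=
  Kernel.traj (X := fun _ => V) (historyKernel nbr) 0 (fun _ => x)

instance chainLaw_isProbabilityMeasure (nbr : V → Finset V) (x : V) :
    IsProbabilityMeasure (chainLaw nbr x) := by
  unfold chainLaw
  infer_instance

/-- The law of a sequence of independent exponential variables of parameter `1`. -/
noncomputable def clockLaw : Measure (ℕ → ℝ) :=
  Measure.infinitePi (fun _ : ℕ => expMeasure 1)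

instance clockLaw_isProbabilityMeasure : IsProbabilityMeasure clockLaw := by
  have : IsProbabilityMeasure (expMeasure 1) := isProbabilityMeasure_expMeasure one_pos
  unfold clockLaw
  infer_instance

/-- The law `ℙ_x` of the walk started from `x`, on the canonical space of pairs (embedded jump
chain, exponential clocks), the two components being independent. -/
noncomputable def walkLaw (nbr : V → Finset V) (x : V) : Measure ((ℕ → V) × (ℕ → ℝ)) :=
  (chainLaw nbr x).prod clockLaw

instance walkLaw_isProbabilityMeasure (nbr : V → Finset V) (x : V) :
    IsProbabilityMeasure (walkLaw nbr x) := by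
  unfold walkLaw
  infer_instance

end Walk

section Path

variable {V : Type*}

/-- The `k`-th jump time `∑_{i < k} E_i / d(Z_i)`, where `Z` is the jump chain, `E` the clocks and
`d(v)` the number of neighbours of `v`: given the chain, the holding time in a state `v` is
exponential of rate `d(v)`, and it is infinite if `v` has no neighbour. -/
noncomputable def jumpTime (nbr : V → Finset V) (ω : (ℕ → V) × (ℕ → ℝ)) (k : ℕ) : ℝ≥0∞ :=
  ∑ i ∈ Finset.range k, ENNReal.ofReal (ω.2 i) / ((nbr (ω.1 i)).card : ℝ≥0∞)

/-- The position `X(t)` of the walk: the state of the jump chain after the jumps up to time `t`. -/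
noncomputable def position (nbr : V → Finset V) (t : ℝ≥0) (ω : (ℕ → V) × (ℕ → ℝ)) : V :=
  ω.1 (sSup {k : ℕ | jumpTime nbr ω k ≤ (t : ℝ≥0∞)})

/-- The event that the walk is definitively in `A`. -/
def definitivelyIn (nbr : V → Finset V) (A : Set V) : Set ((ℕ → V) × (ℕ → ℝ)) :=
  {ω | ∃ T : ℝ≥0, 0 < T ∧ ∀ t : ℝ≥0, T ≤ t → position nbr t ω ∈ A}

/-- The first time at which the walk is in `Δ` (used only when there is such a time). -/
noncomputable def hitTime (nbr : V → Finset V) (Δ : Finset V) (ω : (ℕ → V) × (ℕ → ℝ)) : ℝ≥0 :=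
  sInf {t : ℝ≥0 | position nbr t ω ∈ Δ}

/-- The event `{τ < ∞, X(τ) = y}`, where `τ` is the first time at which the walk is in `Δ`. -/
def hitsAt (nbr : V → Finset V) (Δ : Finset V) (y : V) : Set ((ℕ → V) × (ℕ → ℝ)) :=
  {ω | (∃ t : ℝ≥0, position nbr t ω ∈ Δ) ∧ position nbr (hitTime nbr Δ ω) ω = y}

end Path

/-! ## The geometry -/

/-- The sites of the lattice `ℤ^d`; the first coordinate of `x` is `x 0`. -/
abbrev Site (d : ℕ) : Type := Fin d → ℤ

section Geometry

variable (d : ℕ) [NeZero d]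

/-- The right half lattice `{x : x₁ ≥ n}`. -/
def rightHalf (n : ℕ) : Set (Site d) := {x | (n : ℤ) ≤ x 0}

/-- The left half lattice `{x : x₁ ≤ -n}`. -/
def leftHalf (n : ℕ) : Set (Site d) := {x | x 0 ≤ -(n : ℤ)}

/-- The channel `{x : |x_i| ≤ n for all i}`. -/
def channel (n : ℕ) : Set (Site d) := {x | ∀ i, |x i| ≤ (n : ℤ)}

/-- The infinite domain: two half lattices joined by the channel. -/
def domain (n : ℕ) : Set (Site d) := rightHalf d n ∪ channel d n ∪ leftHalf d n

open Classical in
/-- `Λ_{n,N}`: the sites of the domain in the cube `[-N,N]^d`. -/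
noncomputable def box (n N : ℕ) : Finset (Site d) :=
  (Finset.Icc (fun _ => -(N : ℤ)) (fun _ => (N : ℤ))).filter (fun x => x ∈ domain d n)

/-- `S_{n,N} = Λ_{n,N+1} \ Λ_{n,N}`. -/
noncomputable def shell (n N : ℕ) : Finset (Site d) := box d n (N + 1) \ box d n N

/-- The unit vector `e₁`. -/
def e1 : Site d := Pi.single 0 1

/-- The right face `Δ₊` of the shell. -/
noncomputable def rightFace (n N : ℕ) : Finset (Site d) :=
  (shell d n N).filter (fun y => y - e1 d ∈ box d n N)

/-- The left face `Δ₋` of the shell. -/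
noncomputable def leftFace (n N : ℕ) : Finset (Site d) :=
  (shell d n N).filter (fun y => y + e1 d ∈ box d n N)

/-- The `2d` nearest neighbours of `x` in `ℤ^d`. -/
noncomputable def latticeNbrs {d : ℕ} (x : Site d) : Finset (Site d) :=
  (Finset.Icc (fun i => x i - 1) (fun i => x i + 1)).filter (fun y => ∑ i, |y i - x i| = 1)

/-! ## The walks and the functions `λ` -/

open Classical in
/-- The nearest neighbours of `x` in the infinite domain. -/
noncomputable def domainNbrs (n : ℕ) (x : Site d) : Finset (Site d) :=
  (latticeNbrs x).filter (fun y => y ∈ domain d n)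

/-- The sites to which the finite-volume walk jumps from `x`: the nearest neighbours of `x` in
`Λ_{n,N} ∪ Δ` if `x ∈ Λ_{n,N}`, and none otherwise, so that the walk is absorbed in `Δ`. -/
noncomputable def finiteNbrs (n N : ℕ) (Δ : Finset (Site d)) (x : Site d) : Finset (Site d) :=
  if x ∈ box d n N then (latticeNbrs x).filter (fun y => y ∈ box d n N ∪ Δ) else ∅

/-- `p⁺_x`, the probability that the walk on the domain is definitively in the right half. -/
noncomputable def pPlus (n : ℕ) (x : Site d) : ℝ :=
  (walkLaw (domainNbrs d n) x).real (definitivelyIn (domainNbrs d n) (rightHalf d n))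

/-- `p⁻_x`, the probability that the walk on the domain is definitively in the left half. -/
noncomputable def pMinus (n : ℕ) (x : Site d) : ℝ :=
  (walkLaw (domainNbrs d n) x).real (definitivelyIn (domainNbrs d n) (leftHalf d n))

/-- The function `λ_x = λ⁻ p⁻_x + λ⁺ p⁺_x` (for `x` in the domain). -/
noncomputable def lam (n : ℕ) (lm lp : ℝ) (x : Site d) : ℝ :=
  lm * pMinus d n x + lp * pPlus d n x

/-- The function `λ^{(N,Δ,σ)}_x = ∑_{y ∈ Δ} σ_y ℙ_x(X^{N,Δ}(τ) = y)`, for `x ∈ Λ_{n,N} ∪ Δ`. Only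
the values of `σ` on `Δ` matter. -/
noncomputable def lamFin (n N : ℕ) (Δ : Finset (Site d)) (σ : Site d → ℝ) (x : Site d) : ℝ :=
  ∑ y ∈ Δ, σ y *
    (walkLaw (finiteNbrs d n N Δ) x).real (hitsAt (finiteNbrs d n N Δ) Δ y)

end Geometry

end FickWalk

/-! Almost surely, the events defining `lam` and `lamFin` depend only on the embedded jump chain, so
conditioning on its first step makes both functions harmonic. On a box there is a maximum principle,
since from every site some move parallel to the first axis increases `depth`. With the whole shell
absorbing, the finite and infinite walks have the same neighbours inside the box, so `lamFin - lam`
is harmonic there, vanishes on the shell, and is therefore zero.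

The Fick setting rests on a barrier. For `d ≥ 3` the function `(|w|² + 255)^{-1/4}`, a regularised
`|w|^{-1/2}`, is superharmonic on the lattice. With `w` centred half a step behind the wall it is
invariant under reflection in the wall, hence still superharmonic for the walk in a half lattice. So
a walk started far from the channel stays in its half lattice with probability near `1`
(`one_sub_le_chainLaw_half`), and `lam` is close to the value of that side (`abs_lam_sub_le`). In a
finite box the lateral sides are reflecting; adding a small multiple of the harmonic quadratic
`lateral` makes the barrier nondecreasing across them, and comparison shows that `lamFin` is close
to the same value (`abs_lamFin_sub_le_boxBarrier`). Thus both functions nearly agree on the shell of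
an intermediate box of size `R < N`, and by the maximum principle inside it
(`abs_lamFin_sub_lam_le`). It remains to take `R` large and then `N → ∞`. -/

namespace FickWalk

/-! ### The embedded jump chain: cylinders, Markov property, first-step analysis. -/

section Chain

variable {V : Type*}

/-- The set of paths that agree with `z` up to time `n`. -/
def pathCylinder (z : ℕ → V) (n : ℕ) : Set (ℕ → V) := {ω | ∀ i ≤ n, ω i = z i}

lemma pathCylinder_eq_preimage (z : ℕ → V) (n : ℕ) :
    pathCylinder z n =
      Preorder.frestrictLe (π := fun _ : ℕ => V) n ⁻¹' {Preorder.frestrictLe n z} := by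
  ext ω
  simp only [pathCylinder, Set.mem_ofPred_eq, Set.mem_preimage, Set.mem_singleton_iff, funext_iff,
    Subtype.forall, Finset.mem_Iic, Preorder.frestrictLe_apply]

lemma pathCylinder_zero (z : ℕ → V) : pathCylinder z 0 = {ω | ω 0 = z 0} := by
  ext ω; simp [pathCylinder]

/-- The path `z` preceded by the state `x`. -/
def consPath (x : V) (z : ℕ → V) : ℕ → V
  | 0 => x
  | k + 1 => z k

variable [MeasurableSpace V] [MeasurableSingletonClass V]

lemma measurableSet_pathCylinder (z : ℕ → V) (n : ℕ) : MeasurableSet (pathCylinder z n) := by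
  rw [pathCylinder_eq_preimage]
  exact Preorder.measurable_frestrictLe n (measurableSet_singleton _)

variable [Countable V]

/-- On a countable state space the marginal on times up to `n` is determined by its atoms, which are
cylinders; the marginals on initial segments determine all finite marginals, and a projective limit
is unique. -/
lemma measure_ext_of_pathCylinder {μ ν : Measure (ℕ → V)} [IsFiniteMeasure μ] [IsFiniteMeasure ν]
    (h : ∀ z n, μ (pathCylinder z n) = ν (pathCylinder z n)) : μ = ν := by
  have key : ∀ n, μ.map (Preorder.frestrictLe (π := fun _ : ℕ => V) n) =
      ν.map (Preorder.frestrictLe (π := fun _ : ℕ => V) n) := by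
    intro n
    refine Measure.ext_of_singleton fun a => ?_
    rw [Measure.map_apply (by fun_prop) (measurableSet_singleton _),
      Measure.map_apply (by fun_prop) (measurableSet_singleton _)]
    by_cases hz : ∃ z : ℕ → V, Preorder.frestrictLe (π := fun _ : ℕ => V) n z = a
    · obtain ⟨z, rfl⟩ := hz
      rw [← pathCylinder_eq_preimage, h]
    · have : Preorder.frestrictLe (π := fun _ : ℕ => V) n ⁻¹' {a} = ∅ := by
        ext z; simpa using fun h' => hz ⟨z, h'⟩
      rw [this]; simp
  refine IsProjectiveLimit.unique (P := fun I : Finset ℕ => ν.map I.restrict) (fun I => ?_)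
    (fun I => rfl)
  have hI : I.restrict (π := fun _ : ℕ => V) =
      Finset.restrict₂ I.subset_Iic_sup_id ∘ Preorder.frestrictLe (I.sup id) := rfl
  rw [hI, ← Measure.map_map (by fun_prop) (by fun_prop), key,
    Measure.map_map (by fun_prop) (by fun_prop)]
  rfl

lemma chainLaw_start (nbr : V → Finset V) (x : V) : ∀ᵐ ω ∂chainLaw nbr x, ω 0 = x := by
  have h : (chainLaw nbr x).map (Preorder.frestrictLe (π := fun _ : ℕ => V) 0) =
      Measure.dirac (fun _ => x) := by
    rw [chainLaw, Kernel.traj_map_frestrictLe_apply, Kernel.partialTraj_self, Kernel.id_apply]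
  have h2 : ∀ᵐ w ∂(chainLaw nbr x).map (Preorder.frestrictLe (π := fun _ : ℕ => V) 0),
      w ⟨0, by simp⟩ = x := by
    rw [h, ae_dirac_eq]; simp
  exact ae_of_ae_map (by fun_prop) h2

/-- Seen from a history up to time `n`, the next prefix can be that of `z` only if the history is,
so the integral over histories collapses to one atom. -/
lemma chainLaw_pathCylinder_succ (nbr : V → Finset V) (x : V) (z : ℕ → V) (n : ℕ) :
    chainLaw nbr x (pathCylinder z (n + 1)) =
      chainLaw nbr x (pathCylinder z n) * stepMeasure nbr (z n) {z (n + 1)} := by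
  rw [pathCylinder_eq_preimage, pathCylinder_eq_preimage,
    ← Measure.map_apply (by fun_prop) (measurableSet_singleton _),
    ← Measure.map_apply (by fun_prop) (measurableSet_singleton _), chainLaw,
    Kernel.traj_map_frestrictLe_apply, Kernel.traj_map_frestrictLe_apply,
    Kernel.partialTraj_succ_eq_comp (Nat.zero_le n),
    Kernel.comp_apply' _ _ _ (measurableSet_singleton _)]
  have : ∀ w : (Π _ : Finset.Iic n, V),
      Kernel.partialTraj (X := fun _ => V) (historyKernel nbr) n (n + 1) w
        {Preorder.frestrictLe (n + 1) z} =
      Set.indicator {Preorder.frestrictLe n z}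
        (fun _ => stepMeasure nbr (z n) {z (n + 1)}) w := by
    intro w
    have hp : ∀ v : V, IicProdIoc (X := fun _ : ℕ => V) n (n + 1)
        (w, MeasurableEquiv.piSingleton (X := fun _ : ℕ => V) n v) = Preorder.frestrictLe (n + 1) z ↔
          w = Preorder.frestrictLe n z ∧ v = z (n + 1) := by
      intro v
      simp only [funext_iff, Subtype.forall, Finset.mem_Iic]
      constructor
      · intro h
        refine ⟨fun i hi => ?_, ?_⟩
        · simpa [IicProdIoc, hi] using h i (by omega)
        · have := h (n + 1) le_rfl
          simpa [IicProdIoc, MeasurableEquiv.piSingleton] using this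
      · rintro ⟨h1, h2⟩ i hi
        by_cases hin : i ≤ n
        · simpa [IicProdIoc, hin] using h1 i hin
        · obtain rfl : i = n + 1 := by omega
          simpa [IicProdIoc, MeasurableEquiv.piSingleton] using h2
    have hm : MeasurableSet (IicProdIoc (X := fun _ : ℕ => V) n (n + 1) ⁻¹'
        {Preorder.frestrictLe (n + 1) z}) := by
      have : Measurable (IicProdIoc (X := fun _ : ℕ => V) n (n + 1)) := by fun_prop
      exact this (measurableSet_singleton _)
    rw [Kernel.partialTraj_succ_self, Kernel.map_apply' _ (by fun_prop) _ (measurableSet_singleton _),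
      Kernel.id_prod_apply' _ _ hm, Kernel.map_apply' _ (MeasurableEquiv.measurable _) _
        (measurable_prodMk_left hm)]
    have hs : (MeasurableEquiv.piSingleton (X := fun _ : ℕ => V) n) ⁻¹' (Prod.mk w ⁻¹'
        (IicProdIoc (X := fun _ : ℕ => V) n (n + 1) ⁻¹' {Preorder.frestrictLe (n + 1) z})) =
        {v | w = Preorder.frestrictLe n z ∧ v = z (n + 1)} := by
      ext v
      exact hp v
    rw [hs]
    by_cases hw : w = Preorder.frestrictLe n z
    · subst hw
      simp [historyKernel, stepKernel]
      rfl
    · simp [hw]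
  simp_rw [this]
  rw [lintegral_indicator_const (measurableSet_singleton _), mul_comm]

lemma chainLaw_pathCylinder_of_ne (nbr : V → Finset V) {x : V} {z : ℕ → V} (h : x ≠ z 0) (n : ℕ) :
    chainLaw nbr x (pathCylinder z n) = 0 := by
  refine measure_mono_null (t := {ω | ¬ ω 0 = x}) (fun ω hω h0 => ?_) (chainLaw_start nbr x)
  exact h (h0.symm.trans (hω 0 (Nat.zero_le n)))

lemma chainLaw_pathCylinder_zero (nbr : V → Finset V) (z : ℕ → V) :
    chainLaw nbr (z 0) (pathCylinder z 0) = 1 := by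
  rw [pathCylinder_zero]
  have h := chainLaw_start nbr (z 0)
  rwa [← mem_ae_iff_prob_eq_one]
  exact measurable_pi_apply (X := fun _ => V) 0 (measurableSet_singleton (z 0))

/-- The induction lengthens the cylinder at its far end, where both sides acquire the same
transition factor. This turns the recursion at the last step into one at the first step. -/
lemma chainLaw_pathCylinder_cons (nbr : V → Finset V) (x : V) (z : ℕ → V) (n : ℕ) :
    chainLaw nbr x (pathCylinder (consPath x z) (n + 1)) =
      stepMeasure nbr x {z 0} * chainLaw nbr (z 0) (pathCylinder z n) := by
  induction n with
  | zero =>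
    have h : chainLaw nbr x (pathCylinder (consPath x z) 0) = 1 :=
      chainLaw_pathCylinder_zero nbr (consPath x z)
    rw [chainLaw_pathCylinder_succ, chainLaw_pathCylinder_zero, h, one_mul, mul_one]
    rfl
  | succ n ih =>
    rw [chainLaw_pathCylinder_succ, ih, chainLaw_pathCylinder_succ, mul_assoc]
    rfl

/-- The Markov property at time `1`. -/
lemma chainLaw_map_shift (nbr : V → Finset V) (x : V) :
    (chainLaw nbr x).map (fun ω k => ω (k + 1)) = (stepMeasure nbr x).bind (chainLaw nbr) := by
  have hk : Measurable (chainLaw nbr) := Measurable.of_discrete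
  have : IsProbabilityMeasure ((stepMeasure nbr x).bind (chainLaw nbr)) :=
    isProbabilityMeasure_bind hk.aemeasurable (ae_of_all _ fun y => inferInstance)
  have hs : Measurable (fun (ω : ℕ → V) k => ω (k + 1)) := by fun_prop
  have : IsProbabilityMeasure ((chainLaw nbr x).map (fun ω k => ω (k + 1))) :=
    Measure.isProbabilityMeasure_map hs.aemeasurable
  refine measure_ext_of_pathCylinder fun z n => ?_
  rw [Measure.map_apply hs (measurableSet_pathCylinder z n),
    Measure.bind_apply (measurableSet_pathCylinder z n) hk.aemeasurable]
  have h1 : chainLaw nbr x ((fun ω k => ω (k + 1)) ⁻¹' pathCylinder z n) =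
      chainLaw nbr x (pathCylinder (consPath x z) (n + 1)) := by
    refine measure_congr ?_
    filter_upwards [chainLaw_start nbr x] with ω hω
    refine propext ⟨fun h i hi => ?_, fun h i hi => h (i + 1) (by omega)⟩
    cases i with
    | zero => exact hω
    | succ i => exact h i (by omega)
  -- Only the first step to `z 0` contributes, so the mixture over `y` reduces to one term.
  have h2 : ∀ y, chainLaw nbr y (pathCylinder z n) =
      Set.indicator {z 0} (fun _ => chainLaw nbr (z 0) (pathCylinder z n)) y := by
    intro y
    by_cases hy : y = z 0
    · subst hy; simp
    · rw [chainLaw_pathCylinder_of_ne nbr hy, Set.indicator_of_notMem (by simpa using hy)]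
  rw [h1, chainLaw_pathCylinder_cons, lintegral_congr h2,
    lintegral_indicator_const (measurableSet_singleton _), mul_comm]

lemma chainLaw_shift (nbr : V → Finset V) (x : V) {B : Set (ℕ → V)} (hB : MeasurableSet B) :
    chainLaw nbr x {ω | (fun k => ω (k + 1)) ∈ B} = ∫⁻ y, chainLaw nbr y B ∂stepMeasure nbr x := by
  have hs : Measurable (fun (ω : ℕ → V) k => ω (k + 1)) := by fun_prop
  have hk : Measurable (chainLaw nbr) := Measurable.of_discrete
  rw [← Measure.bind_apply hB hk.aemeasurable, ← chainLaw_map_shift, Measure.map_apply hs hB]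
  rfl

lemma chainLaw_shift_of_empty (nbr : V → Finset V) {x : V} (hx : nbr x = ∅) {B : Set (ℕ → V)}
    (hB : MeasurableSet B) :
    chainLaw nbr x {ω | (fun k => ω (k + 1)) ∈ B} = chainLaw nbr x B := by
  rw [chainLaw_shift nbr x hB, stepMeasure, dif_neg (by simp [hx]), lintegral_dirac]

/-- First-step analysis: `|nbr x| ℙ_x(shift ∈ B) = ∑_{y ∈ nbr x} ℙ_y(B)`. -/
lemma card_mul_chainLaw_real_shift (nbr : V → Finset V) (x : V) {B : Set (ℕ → V)}
    (hB : MeasurableSet B) :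
    ((nbr x).card : ℝ) * (chainLaw nbr x).real {ω | (fun k => ω (k + 1)) ∈ B} =
      ∑ y ∈ nbr x, (chainLaw nbr y).real B := by
  -- Without neighbours both sides vanish; multiplying by the cardinality lets the identity cover
  -- absorbing states.
  rcases (nbr x).eq_empty_or_nonempty with h | h
  · simp [h]
  classical
  have hc : ((nbr x).card : ℝ≥0∞) ≠ 0 := by simpa using h.ne_empty
  have e : ((nbr x).card : ℝ≥0∞) * chainLaw nbr x {ω | (fun k => ω (k + 1)) ∈ B} =
      ∑ y ∈ nbr x, chainLaw nbr y B := by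
    rw [chainLaw_shift nbr x hB, stepMeasure, dif_pos h, lintegral_countable']
    have : ∀ a, chainLaw nbr a B * (PMF.uniformOfFinset (nbr x) h).toMeasure {a} =
        if a ∈ nbr x then chainLaw nbr a B * ((nbr x).card : ℝ≥0∞)⁻¹ else 0 := by
      intro a
      rw [PMF.toMeasure_apply_singleton _ _ (measurableSet_singleton _),
        PMF.uniformOfFinset_apply, mul_ite, mul_zero]
    simp_rw [this]
    rw [tsum_eq_sum (s := nbr x) (fun a ha => by simp [ha]),
      Finset.sum_congr rfl (fun a ha => if_pos ha), ← Finset.sum_mul, mul_comm, mul_assoc,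
      ENNReal.inv_mul_cancel hc (ENNReal.natCast_ne_top _), mul_one]
  have := congrArg ENNReal.toReal e
  rw [ENNReal.toReal_mul, ENNReal.toReal_natCast,
    ENNReal.toReal_sum (fun _ _ => measure_ne_top _ _)] at this
  exact this

/-- The chain stays where it is at states without neighbours. -/
lemma chainLaw_absorbed (nbr : V → Finset V) (x : V) :
    ∀ᵐ ω ∂chainLaw nbr x, ∀ i, nbr (ω i) = ∅ → ω (i + 1) = ω i := by
  rw [ae_all_iff]
  intro i
  have hm : ∀ i, MeasurableSet {ω : ℕ → V | ¬ (nbr (ω i) = ∅ → ω (i + 1) = ω i)} := by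
    intro i
    have : Measurable fun ω : ℕ → V => (ω i, ω (i + 1)) := by fun_prop
    exact this (t := {p | ¬ (nbr p.1 = ∅ → p.2 = p.1)}) (Set.to_countable _).measurableSet
  induction i generalizing x with
  | zero =>
    by_cases hx : nbr x = ∅
    · have h0 : MeasurableSet {ω : ℕ → V | ω 0 = x} :=
        measurable_pi_apply (X := fun _ => V) 0 (measurableSet_singleton x)
      have h1 := chainLaw_shift_of_empty nbr hx h0.compl
      have h2 : chainLaw nbr x {ω | ω 0 = x}ᶜ = 0 := chainLaw_start nbr x
      rw [h2] at h1
      have h3 : ∀ᵐ ω ∂chainLaw nbr x, ω 1 = x := h1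
      filter_upwards [chainLaw_start nbr x, h3] with ω h0 h1 _
      rw [h0, ← h1]
    · filter_upwards [chainLaw_start nbr x] with ω h0 h
      rw [h0] at h
      exact absurd h hx
  | succ i ih =>
    -- The exceptional event at time `i + 1` is the shift of the one at time `i`, which is null from
    -- every starting point.
    have := chainLaw_shift nbr x (hm i)
    exact this.trans ((lintegral_congr (g := fun _ => 0) (fun y => ih y)).trans lintegral_zero)

end Chain

/-! ### The exponential clocks. -/

section Clocks

lemma expMeasure_one_Iic (t : ℝ) (ht : 0 ≤ t) :
    expMeasure 1 (Set.Iic t) = ENNReal.ofReal (1 - Real.exp (-t)) := by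
  have : IsProbabilityMeasure (expMeasure 1) := isProbabilityMeasure_expMeasure one_pos
  have h := cdf_expMeasure_eq one_pos t
  rw [cdf_eq_real, if_pos ht, one_mul] at h
  rw [← h, ofReal_measureReal]

/-- Almost surely, all clocks are positive. -/
lemma clockLaw_pos : ∀ᵐ e ∂clockLaw, ∀ i, 0 < e i := by
  have : IsProbabilityMeasure (expMeasure 1) := isProbabilityMeasure_expMeasure one_pos
  rw [ae_all_iff]
  intro i
  have h : clockLaw (Set.pi ({i} : Finset ℕ) fun _ => Set.Iic (0 : ℝ)) = 0 := by
    rw [clockLaw, Measure.infinitePi_pi _ (fun _ _ => measurableSet_Iic)]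
    simp [expMeasure_one_Iic]
  refine measure_mono_null (fun e he => ?_) h
  simpa using he

/-- Almost surely, the sum of the clocks is infinite. -/
lemma clockLaw_frequently : ∀ᵐ e ∂clockLaw, ∀ m, ∃ i, m ≤ i ∧ 1 < e i := by
  have : IsProbabilityMeasure (expMeasure 1) := isProbabilityMeasure_expMeasure one_pos
  rw [ae_all_iff]
  intro m
  set p := expMeasure 1 (Set.Iic (1 : ℝ)) with hp
  have hp1 : p < 1 := by
    rw [hp, expMeasure_one_Iic 1 zero_le_one, ENNReal.ofReal_lt_one]
    linarith [Real.exp_pos (-1)]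
  -- The `k` clocks from index `m` on are all at most `1` with probability `p ^ k`, which tends to
  -- `0`.
  have h : ∀ k, clockLaw {e | ¬ ∃ i, m ≤ i ∧ 1 < e i} ≤ p ^ k := by
    intro k
    have : clockLaw (Set.pi (Finset.Ico m (m + k)) fun _ => Set.Iic (1 : ℝ)) = p ^ k := by
      rw [clockLaw, Measure.infinitePi_pi _ (fun _ _ => measurableSet_Iic)]
      simp [hp]
    rw [← this]
    refine measure_mono (fun e he i hi => ?_)
    simp only [Finset.coe_Ico, Set.mem_Ico] at hi
    by_contra hlt
    exact he ⟨i, hi.1, by simpa using hlt⟩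
  exact le_antisymm (ge_of_tendsto' (ENNReal.tendsto_pow_atTop_nhds_zero_of_lt_one hp1) h)
    zero_le

lemma exists_le_sum_of_frequently {e : ℕ → ℝ} (h0 : ∀ i, 0 < e i)
    (h : ∀ m, ∃ i, m ≤ i ∧ 1 < e i) (M : ℕ) : ∃ k, (M : ℝ) ≤ ∑ i ∈ Finset.range k, e i := by
  induction M with
  | zero => exact ⟨0, by simp⟩
  | succ M ih =>
    obtain ⟨k, hk⟩ := ih
    obtain ⟨i, hi, h1⟩ := h k
    refine ⟨i + 1, ?_⟩
    rw [Finset.sum_range_succ]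
    have := Finset.sum_le_sum_of_subset_of_nonneg (f := e) (Finset.range_subset_range.2 hi)
      (fun j _ _ => (h0 j).le)
    push_cast
    linarith

end Clocks

/-! ### Pathwise reduction from continuous time to the jump chain. -/

section Paths

variable {V : Type*}

/-- Paths of the walk along which nothing exceptional happens. -/
structure IsRegular (nbr : V → Finset V) (ω : (ℕ → V) × (ℕ → ℝ)) : Prop where
  absorbed : ∀ i, nbr (ω.1 i) = ∅ → ω.1 (i + 1) = ω.1 i
  clock_pos : ∀ i, 0 < ω.2 i
  clock_frequently : ∀ m, ∃ i, m ≤ i ∧ 1 < ω.2 i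

lemma jumpTime_succ (nbr : V → Finset V) (ω : (ℕ → V) × (ℕ → ℝ)) (k : ℕ) :
    jumpTime nbr ω (k + 1) =
      jumpTime nbr ω k + ENNReal.ofReal (ω.2 k) / ((nbr (ω.1 k)).card : ℝ≥0∞) :=
  Finset.sum_range_succ _ _

lemma jumpTime_zero (nbr : V → Finset V) (ω : (ℕ → V) × (ℕ → ℝ)) : jumpTime nbr ω 0 = 0 := rfl

lemma jumpTime_mono (nbr : V → Finset V) (ω : (ℕ → V) × (ℕ → ℝ)) : Monotone (jumpTime nbr ω) :=
  monotone_nat_of_le_succ fun k => by rw [jumpTime_succ]; exact le_self_add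

/-- The number of jumps up to time `t`. -/
noncomputable def jumpCount (nbr : V → Finset V) (t : ℝ≥0) (ω : (ℕ → V) × (ℕ → ℝ)) : ℕ :=
  sSup {k : ℕ | jumpTime nbr ω k ≤ (t : ℝ≥0∞)}

lemma position_eq (nbr : V → Finset V) (t : ℝ≥0) (ω : (ℕ → V) × (ℕ → ℝ)) :
    position nbr t ω = ω.1 (jumpCount nbr t ω) := rfl

namespace IsRegular

variable {nbr : V → Finset V} {ω : (ℕ → V) × (ℕ → ℝ)}

lemma jumpTime_lt_succ (h : IsRegular nbr ω) {k : ℕ} (hk : jumpTime nbr ω k ≠ ⊤) :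
    jumpTime nbr ω k < jumpTime nbr ω (k + 1) := by
  rw [jumpTime_succ]
  exact ENNReal.lt_add_right hk
    (ENNReal.div_pos (ENNReal.ofReal_pos.2 (h.clock_pos k)).ne' (ENNReal.natCast_ne_top _)).ne'

lemma eq_of_absorbed (h : IsRegular nbr ω) {j : ℕ} (hj : nbr (ω.1 j) = ∅) {k : ℕ} (hk : j ≤ k) :
    ω.1 k = ω.1 j := by
  induction k, hk using Nat.le_induction with
  | base => rfl
  | succ k _ ih => rw [h.absorbed k (ih ▸ hj), ih]

/-- The state after `k` jumps is reached at a finite time, at a jump after which the walk does not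
move before the `k`-th one. -/
lemma exists_jumpTime_ne_top (h : IsRegular nbr ω) (k : ℕ) :
    ∃ j ≤ k, jumpTime nbr ω j ≠ ⊤ ∧ ∀ m, j ≤ m → m ≤ k → ω.1 m = ω.1 k := by
  by_cases hk : jumpTime nbr ω k = ⊤
  -- A jump time becomes infinite only through an infinite holding time, that is, at a state without
  -- neighbours reached at a finite time.
  · have hex : ∃ j < k, jumpTime nbr ω j ≠ ⊤ ∧ nbr (ω.1 j) = ∅ := by
      induction k with
      | zero => simp [jumpTime_zero] at hk
      | succ k ih =>
        by_cases hk' : jumpTime nbr ω k = ⊤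
        · obtain ⟨j, hj, hj'⟩ := ih hk'
          exact ⟨j, by omega, hj'⟩
        · refine ⟨k, by omega, hk', ?_⟩
          rw [jumpTime_succ, ENNReal.add_eq_top, or_iff_right hk', ENNReal.div_eq_top] at hk
          exact (by simpa using hk : 0 < ω.2 k ∧ nbr (ω.1 k) = ∅).2
    obtain ⟨j, hj, hj1, hj2⟩ := hex
    exact ⟨j, hj.le, hj1, fun m hm hmk => by
      rw [h.eq_of_absorbed hj2 hm, h.eq_of_absorbed hj2 hj.le]⟩
  · exact ⟨k, le_rfl, hk, fun m h1 h2 => by rw [le_antisymm h1 h2]⟩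

variable {D : ℕ}

/-- No explosion: with degrees bounded by `D`, the `i`-th holding time is at least `E_i / (D + 1)`,
and the clocks have infinite sum. Using `D + 1` avoids a zero denominator when `D = 0`. -/
lemma exists_lt_jumpTime (h : IsRegular nbr ω) (hD : ∀ v, (nbr v).card ≤ D) (t : ℝ≥0) :
    ∃ k, (t : ℝ≥0∞) < jumpTime nbr ω k := by
  obtain ⟨M, hM⟩ := exists_nat_gt ((t : ℝ) * (D + 1))
  obtain ⟨k, hk⟩ := exists_le_sum_of_frequently h.clock_pos h.clock_frequently M
  refine ⟨k, ?_⟩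
  have h1 : ENNReal.ofReal (∑ i ∈ Finset.range k, ω.2 i) / ((D + 1 : ℕ) : ℝ≥0∞) ≤
      jumpTime nbr ω k := by
    rw [ENNReal.ofReal_sum_of_nonneg (fun i _ => (h.clock_pos i).le), div_eq_mul_inv,
      Finset.sum_mul]
    refine Finset.sum_le_sum fun i _ => ?_
    rw [← div_eq_mul_inv]
    gcongr
    exact (hD _).trans (Nat.le_succ D)
  refine lt_of_lt_of_le ?_ h1
  rw [ENNReal.lt_div_iff_mul_lt (by simp) (by simp)]
  have : ((t : ℝ≥0∞) * ((D + 1 : ℕ) : ℝ≥0∞)) = ENNReal.ofReal ((t : ℝ) * (D + 1)) := by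
    rw [ENNReal.ofReal_mul t.coe_nonneg, ENNReal.ofReal_coe_nnreal]
    congr 1
    rw [← ENNReal.ofReal_natCast]
    push_cast
    rfl
  rw [this]
  exact (ENNReal.ofReal_lt_ofReal_iff (lt_of_le_of_lt (by positivity) (hM.trans_le hk))).2
    (hM.trans_le hk)

/-- Without explosion the set of jump indices up to time `t` is bounded, so its `sSup` is an
attained maximum and not the default value `0`. -/
lemma le_jumpCount_iff (h : IsRegular nbr ω) (hD : ∀ v, (nbr v).card ≤ D) {t : ℝ≥0} {k : ℕ} :
    k ≤ jumpCount nbr t ω ↔ jumpTime nbr ω k ≤ t := by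
  obtain ⟨m, hm⟩ := h.exists_lt_jumpTime hD t
  have hb : BddAbove {k : ℕ | jumpTime nbr ω k ≤ (t : ℝ≥0∞)} :=
    ⟨m, fun k hk => le_of_not_gt fun hlt =>
      absurd (hm.trans_le (jumpTime_mono nbr ω hlt.le)) (not_lt.2 hk)⟩
  refine ⟨fun hk => ?_, fun hk => le_csSup hb hk⟩
  have hne : {k : ℕ | jumpTime nbr ω k ≤ (t : ℝ≥0∞)}.Nonempty := ⟨0, by simp [jumpTime_zero]⟩
  exact (jumpTime_mono nbr ω hk).trans (Nat.sSup_mem hne hb)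

lemma jumpCount_jumpTime (h : IsRegular nbr ω) (hD : ∀ v, (nbr v).card ≤ D) {k : ℕ}
    (hk : jumpTime nbr ω k ≠ ⊤) : jumpCount nbr (jumpTime nbr ω k).toNNReal ω = k := by
  refine le_antisymm (le_of_not_gt fun hlt => ?_) ?_
  · have := (h.le_jumpCount_iff hD).1 (Nat.succ_le_of_lt hlt)
    rw [ENNReal.coe_toNNReal hk] at this
    exact absurd (h.jumpTime_lt_succ hk) (not_lt.2 this)
  · rw [h.le_jumpCount_iff hD, ENNReal.coe_toNNReal hk]

lemma position_jumpTime (h : IsRegular nbr ω) (hD : ∀ v, (nbr v).card ≤ D) {k : ℕ}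
    (hk : jumpTime nbr ω k ≠ ⊤) : position nbr (jumpTime nbr ω k).toNNReal ω = ω.1 k := by
  rw [position_eq, h.jumpCount_jumpTime hD hk]

/-- The walk is definitively in `A` iff its jump chain is. -/
lemma mem_definitivelyIn_iff (h : IsRegular nbr ω) (hD : ∀ v, (nbr v).card ≤ D) (A : Set V) :
    ω ∈ definitivelyIn nbr A ↔ ∀ᶠ k in atTop, ω.1 k ∈ A := by
  constructor
  · rintro ⟨T, -, hT⟩
    refine eventually_atTop.2 ⟨jumpCount nbr T ω, fun k hk => ?_⟩
    obtain ⟨j, hjk, hj, hm⟩ := h.exists_jumpTime_ne_top k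
    -- The state `ω.1 k` is occupied from the finite `j`-th jump time on. If that time precedes `T`,
    -- the number of jumps up to `T` lies between `j` and `k`, and the walk is in this state at `T`.
    rcases le_total T (jumpTime nbr ω j).toNNReal with hle | hle
    · have := hT _ hle
      rwa [h.position_jumpTime hD hj, hm j le_rfl hjk] at this
    · have hjT : j ≤ jumpCount nbr T ω := by
        rw [h.le_jumpCount_iff hD, ← ENNReal.coe_toNNReal hj]
        exact_mod_cast hle
      have := hT T le_rfl
      rwa [position_eq, hm _ hjT hk] at this
  · intro hA
    obtain ⟨m, hm⟩ := eventually_atTop.1 hA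
    obtain ⟨j, hjm, hj, hc⟩ := h.exists_jumpTime_ne_top m
    -- The added `1` makes the time strictly positive, even for `j = 0`.
    refine ⟨(jumpTime nbr ω j).toNNReal + 1, by positivity, fun t ht => ?_⟩
    have hjt : j ≤ jumpCount nbr t ω := by
      rw [h.le_jumpCount_iff hD, ← ENNReal.coe_toNNReal hj]
      exact_mod_cast le_self_add.trans ht
    rw [position_eq]
    rcases le_total m (jumpCount nbr t ω) with hle | hle
    · exact hm _ hle
    · rw [hc _ hjt hle]
      exact hm m le_rfl

end IsRegular

/-- The paths whose first state in `Δ` is `y`. -/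
def firstHitAt (Δ : Finset V) (y : V) : Set (ℕ → V) :=
  {z | ∃ k, z k ∈ Δ ∧ z k = y ∧ ∀ j < k, z j ∉ Δ}

lemma IsRegular.mem_hitsAt_iff {nbr : V → Finset V} {ω : (ℕ → V) × (ℕ → ℝ)} {D : ℕ}
    (h : IsRegular nbr ω) (hD : ∀ v, (nbr v).card ≤ D) (Δ : Finset V) (y : V) :
    ω ∈ hitsAt nbr Δ y ↔ ω.1 ∈ firstHitAt Δ y := by
  have key : ∀ k, ω.1 k ∈ Δ → (∀ j < k, ω.1 j ∉ Δ) →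
      position nbr (hitTime nbr Δ ω) ω = ω.1 k := by
    intro k hk hj
    -- Otherwise state `k` would repeat a state reached earlier, contradicting that `k` is the first
    -- visit to `Δ`. The hitting time is then this jump time, so the infimum is attained.
    have hfin : jumpTime nbr ω k ≠ ⊤ := by
      obtain ⟨j, hjk, hj', hm⟩ := h.exists_jumpTime_ne_top k
      rcases hjk.eq_or_lt with rfl | hlt
      · exact hj'
      · exact absurd (hm j le_rfl hjk ▸ hk) (hj j hlt)
    have hleast : IsLeast {t : ℝ≥0 | position nbr t ω ∈ Δ} (jumpTime nbr ω k).toNNReal := by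
      refine ⟨?_, fun t ht => ?_⟩
      · rwa [Set.mem_ofPred_eq, h.position_jumpTime hD hfin]
      · have : k ≤ jumpCount nbr t ω := le_of_not_gt fun hlt => hj _ hlt ht
        rw [h.le_jumpCount_iff hD] at this
        simpa using ENNReal.toNNReal_mono ENNReal.coe_ne_top this
    rw [hitTime, hleast.csInf_eq, h.position_jumpTime hD hfin]
  classical
  constructor
  · rintro ⟨⟨t, ht⟩, hy⟩
    have hex : ∃ k, ω.1 k ∈ Δ := ⟨_, ht⟩
    exact ⟨Nat.find hex, Nat.find_spec hex,
      (key _ (Nat.find_spec hex) fun j hj => Nat.find_min hex hj).symm.trans hy,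
      fun j hj => Nat.find_min hex hj⟩
  · rintro ⟨k, hk, rfl, hj⟩
    refine ⟨⟨hitTime nbr Δ ω, ?_⟩, key k hk hj⟩
    rwa [key k hk hj]

end Paths

/-! ### Transfer of probabilities from the walk to the jump chain. -/

section WalkLaw

variable {V : Type*} [MeasurableSpace V] [MeasurableSingletonClass V] [Countable V]

lemma walkLaw_isRegular (nbr : V → Finset V) (x : V) :
    ∀ᵐ ω ∂walkLaw nbr x, IsRegular nbr ω := by
  have h1 : ∀ᵐ ω ∂walkLaw nbr x, ∀ i, nbr (ω.1 i) = ∅ → ω.1 (i + 1) = ω.1 i :=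
    Measure.quasiMeasurePreserving_fst.ae (chainLaw_absorbed nbr x)
  have h2 : ∀ᵐ ω ∂walkLaw nbr x, (∀ i, 0 < ω.2 i) ∧ ∀ m, ∃ i, m ≤ i ∧ 1 < ω.2 i :=
    Measure.quasiMeasurePreserving_snd.ae (clockLaw_pos.and clockLaw_frequently)
  filter_upwards [h1, h2] with ω h1 h2
  exact ⟨h1, h2.1, h2.2⟩

lemma walkLaw_real_fst_mem (nbr : V → Finset V) (x : V) (B : Set (ℕ → V)) :
    (walkLaw nbr x).real {ω | ω.1 ∈ B} = (chainLaw nbr x).real B := by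
  have : {ω : (ℕ → V) × (ℕ → ℝ) | ω.1 ∈ B} = B ×ˢ Set.univ := by ext; simp
  rw [this, walkLaw, measureReal_prod_prod, probReal_univ, mul_one]

lemma walkLaw_real_definitivelyIn {nbr : V → Finset V} {D : ℕ} (hD : ∀ v, (nbr v).card ≤ D) (x : V)
    (A : Set V) :
    (walkLaw nbr x).real (definitivelyIn nbr A) =
      (chainLaw nbr x).real {z | ∀ᶠ k in atTop, z k ∈ A} := by
  rw [← walkLaw_real_fst_mem]
  refine measureReal_congr ?_
  filter_upwards [walkLaw_isRegular nbr x] with ω h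
  exact propext (h.mem_definitivelyIn_iff hD A)

lemma walkLaw_real_hitsAt {nbr : V → Finset V} {D : ℕ} (hD : ∀ v, (nbr v).card ≤ D) (x : V)
    (Δ : Finset V) (y : V) :
    (walkLaw nbr x).real (hitsAt nbr Δ y) = (chainLaw nbr x).real (firstHitAt Δ y) := by
  rw [← walkLaw_real_fst_mem]
  refine measureReal_congr ?_
  filter_upwards [walkLaw_isRegular nbr x] with ω h
  exact propext (h.mem_hitsAt_iff hD Δ y)

end WalkLaw

/-! ### Algebra of the generator and the maximum principle. -/

section Potential

variable {V : Type*}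

lemma generator_eq (nbr : V → Finset V) (ψ : V → ℝ) (x : V) :
    generator nbr ψ x = ∑ y ∈ nbr x, ψ y - (nbr x).card * ψ x := by
  rw [generator, Finset.sum_sub_distrib, Finset.sum_const, nsmul_eq_mul]

lemma generator_add (nbr : V → Finset V) (ψ φ : V → ℝ) (x : V) :
    generator nbr (fun y => ψ y + φ y) x = generator nbr ψ x + generator nbr φ x := by
  simp only [generator, ← Finset.sum_add_distrib]
  exact Finset.sum_congr rfl fun y _ => by ring

lemma generator_const_mul (nbr : V → Finset V) (a : ℝ) (ψ : V → ℝ) (x : V) :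
    generator nbr (fun y => a * ψ y) x = a * generator nbr ψ x := by
  simp only [generator, Finset.mul_sum]
  exact Finset.sum_congr rfl fun y _ => by ring

lemma generator_const (nbr : V → Finset V) (a : ℝ) (x : V) :
    generator nbr (fun _ => a) x = 0 := by
  simp [generator]

lemma generator_sum {ι : Type*} (s : Finset ι) (nbr : V → Finset V) (ψ : ι → V → ℝ) (x : V) :
    generator nbr (fun y => ∑ i ∈ s, ψ i y) x = ∑ i ∈ s, generator nbr (ψ i) x := by
  simp only [generator, ← Finset.sum_sub_distrib]
  exact Finset.sum_comm

/-- The maximum principle for subharmonic functions on a finite set from which one escapes along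
a path that increases `φ`. -/
lemma le_of_subharmonic (nbr : V → Finset V) (B : Finset V) (u : V → ℝ) (m : ℝ)
    (φ : V → ℤ) (hφ : ∀ x ∈ B, ∃ y ∈ nbr x, φ x < φ y)
    (hu : ∀ x ∈ B, 0 ≤ generator nbr u x)
    (hm : ∀ x ∈ B, ∀ y ∈ nbr x, y ∉ B → u y ≤ m) : ∀ x ∈ B, u x ≤ m := by
  classical
  intro x₀ hx₀
  obtain ⟨x₁, hx₁, hmax⟩ := B.exists_max_image u ⟨x₀, hx₀⟩
  by_contra! hlt
  have hM : m < u x₁ := hlt.trans_le (hmax x₀ hx₀)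
  -- Among the maximisers of `u` one with `φ` maximal is chosen. Subharmonicity forces all its
  -- neighbours to be maximisers too, in `B` since the maximum exceeds `m`, and one of them has
  -- larger `φ`.
  obtain ⟨x, hx, hxmax⟩ := (B.filter fun y => u y = u x₁).exists_max_image φ
    ⟨x₁, Finset.mem_filter.2 ⟨hx₁, rfl⟩⟩
  obtain ⟨hxB, hux⟩ := Finset.mem_filter.1 hx
  obtain ⟨y, hy, hxy⟩ := hφ x hxB
  have hle : ∀ z ∈ nbr x, u z - u x ≤ 0 := by
    intro z hz
    rw [hux]
    by_cases hzB : z ∈ B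
    · linarith [hmax z hzB]
    · linarith [hm x hxB z hz hzB]
  have h0 : ∑ z ∈ nbr x, (u z - u x) = 0 := le_antisymm (Finset.sum_nonpos hle) (hu x hxB)
  have hyu : u y = u x₁ := by
    have := (Finset.sum_eq_zero_iff_of_nonpos hle).1 h0 y hy
    linarith
  have hyB : y ∈ B := by
    by_contra hyB
    linarith [hm x hxB y hy hyB]
  exact absurd (hxmax y (Finset.mem_filter.2 ⟨hyB, hyu⟩)) (not_le.2 hxy)

/-- A harmonic function is bounded by its boundary values. -/
lemma abs_le_of_harmonic (nbr : V → Finset V) (B : Finset V) (u : V → ℝ) (m : ℝ)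
    (φ : V → ℤ) (hφ : ∀ x ∈ B, ∃ y ∈ nbr x, φ x < φ y)
    (hu : ∀ x ∈ B, generator nbr u x = 0)
    (hm : ∀ x ∈ B, ∀ y ∈ nbr x, y ∉ B → |u y| ≤ m) : ∀ x ∈ B, |u x| ≤ m := by
  intro x hx
  refine abs_le'.2 ⟨le_of_subharmonic nbr B u m φ hφ (fun x hx => (hu x hx).ge)
    (fun x hx y hy hyB => (le_abs_self _).trans (hm x hx y hy hyB)) x hx, ?_⟩
  have := le_of_subharmonic nbr B (fun y => -1 * u y) m φ hφ
    (fun x hx => by rw [generator_const_mul, hu x hx, mul_zero])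
    (fun x hx y hy hyB => by linarith [neg_abs_le (u y), hm x hx y hy hyB]) x hx
  linarith

end Potential

/-! ### Harmonicity of path probabilities, and escape estimates by superharmonic functions. -/

section FirstStep

variable {V : Type*} [MeasurableSpace V] [MeasurableSingletonClass V] [Countable V]

/-- Shift invariance is required only along paths from `x`; this covers tail events everywhere and
hitting events off the target. -/
lemma generator_chainLaw_real (nbr : V → Finset V) (x : V) {B : Set (ℕ → V)}
    (hB : MeasurableSet B)
    (hx : ∀ z : ℕ → V, z 0 = x → ((fun k => z (k + 1)) ∈ B ↔ z ∈ B)) :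
    generator nbr (fun y => (chainLaw nbr y).real B) x = 0 := by
  rw [generator_eq, ← card_mul_chainLaw_real_shift nbr x hB, ← mul_sub]
  refine mul_eq_zero_of_right _ (sub_eq_zero.2 (measureReal_congr ?_))
  filter_upwards [chainLaw_start nbr x] with ω h
  exact propext (hx ω h)

lemma measurableSet_eval_mem (k : ℕ) (A : Set V) : MeasurableSet {z : ℕ → V | z k ∈ A} :=
  measurable_pi_apply (X := fun _ => V) k A.to_countable.measurableSet

lemma measurableSet_eventually_mem (A : Set V) :
    MeasurableSet {z : ℕ → V | ∀ᶠ k in atTop, z k ∈ A} := by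
  have : {z : ℕ → V | ∀ᶠ k in atTop, z k ∈ A} = ⋃ m, ⋂ k ≥ m, {z : ℕ → V | z k ∈ A} := by
    ext z
    simp [eventually_atTop]
  rw [this]
  exact MeasurableSet.iUnion fun m => MeasurableSet.iInter fun k => MeasurableSet.iInter fun _ =>
    measurableSet_eval_mem k A

lemma generator_chainLaw_eventually (nbr : V → Finset V) (A : Set V) (x : V) :
    generator nbr (fun y => (chainLaw nbr y).real {z | ∀ᶠ k in atTop, z k ∈ A}) x = 0 := by
  refine generator_chainLaw_real nbr x (measurableSet_eventually_mem A) fun z _ => ?_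
  exact Iff.trans (eventually_map (m := (· + 1)) (P := fun k => z k ∈ A)).symm
    (by rw [map_add_atTop_eq_nat]; rfl)

lemma measurableSet_firstHitAt (Δ : Finset V) (y : V) : MeasurableSet (firstHitAt Δ y) := by
  have : firstHitAt Δ y = ⋃ k, ({z : ℕ → V | z k ∈ (Δ : Set V)} ∩ {z | z k ∈ ({y} : Set V)} ∩
      ⋂ j < k, {z : ℕ → V | z j ∈ (Δ : Set V)ᶜ}) := by
    ext z
    simp [firstHitAt, and_assoc]
  rw [this]
  exact MeasurableSet.iUnion fun k => ((measurableSet_eval_mem k _).inter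
    (measurableSet_eval_mem k _)).inter
      (MeasurableSet.iInter fun j => MeasurableSet.iInter fun _ => measurableSet_eval_mem j _)

lemma generator_chainLaw_firstHitAt (nbr : V → Finset V) {Δ : Finset V} (y : V) {x : V}
    (hx : x ∉ Δ) : generator nbr (fun v => (chainLaw nbr v).real (firstHitAt Δ y)) x = 0 := by
  refine generator_chainLaw_real nbr x (measurableSet_firstHitAt Δ y) fun z hz => ?_
  constructor
  · rintro ⟨k, h1, h2, h3⟩
    refine ⟨k + 1, h1, h2, fun j hj => ?_⟩
    cases j with
    | zero => rwa [hz]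
    | succ j => exact h3 j (by omega)
  · rintro ⟨k, h1, h2, h3⟩
    cases k with
    | zero => exact absurd (hz ▸ h1) hx
    | succ k => exact ⟨k, h1, h2, fun j hj => h3 (j + 1) (by omega)⟩

lemma chainLaw_firstHitAt_of_mem (nbr : V → Finset V) {Δ : Finset V} {x : V} (hx : x ∈ Δ)
    [DecidableEq V] (y : V) :
    (chainLaw nbr x).real (firstHitAt Δ y) = if x = y then 1 else 0 := by
  have h : ∀ z : ℕ → V, z 0 = x → (z ∈ firstHitAt Δ y ↔ x = y) := by
    intro z hz
    constructor
    · rintro ⟨k, -, h2, h3⟩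
      cases k with
      | zero => rw [← hz, h2]
      | succ k => exact absurd (hz ▸ hx) (h3 0 (by omega))
    · intro hxy
      exact ⟨0, hz ▸ hx, hz.trans hxy, fun j hj => absurd hj (Nat.not_lt_zero j)⟩
  split_ifs with hxy
  · rw [← probReal_univ (μ := chainLaw nbr x)]
    refine measureReal_congr ?_
    filter_upwards [chainLaw_start nbr x] with z hz
    exact propext (iff_of_true ((h z hz).2 hxy) trivial)
  · rw [← measureReal_empty (μ := chainLaw nbr x)]
    refine measureReal_congr ?_
    filter_upwards [chainLaw_start nbr x] with z hz
    exact propext (iff_of_false (mt (h z hz).1 hxy) id)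

/-- A nonnegative superharmonic function which is at least `1` where the chain may leave `A`
bounds the probability that the chain leaves `A`. -/
lemma one_sub_le_chainLaw_eventually (nbr : V → Finset V) (A : Set V) (f : V → ℝ)
    (h0 : ∀ x ∈ A, 0 ≤ f x)
    (hne : ∀ x ∈ A, (nbr x).Nonempty)
    (hf : ∀ x ∈ A, f x < 1 → (∀ y ∈ nbr x, y ∈ A) ∧ generator nbr f x ≤ 0) {x : V} (hx : x ∈ A) :
    1 - f x ≤ (chainLaw nbr x).real {z | ∀ᶠ k in atTop, z k ∈ A} := by
  set S : ℕ → Set (ℕ → V) := fun k => {z | ∀ i ≤ k, z i ∈ A} with hS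
  have hSm : ∀ k, MeasurableSet (S k) := by
    intro k
    have : S k = ⋂ i ≤ k, {z : ℕ → V | z i ∈ A} := by ext z; simp [hS]
    rw [this]
    exact MeasurableSet.iInter fun i => MeasurableSet.iInter fun _ => measurableSet_eval_mem i A
  -- Optional stopping done by induction on the horizon: the bound is trivial where `f ≥ 1`;
  -- elsewhere every neighbour lies in `A` and superharmonicity propagates it. It is uniform in `k`,
  -- so it survives the limit.
  have key : ∀ k, ∀ x ∈ A, 1 - f x ≤ (chainLaw nbr x).real (S k) := by
    intro k
    induction k with
    | zero =>
      intro x hx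
      have : (chainLaw nbr x).real (S 0) = 1 := by
        rw [← probReal_univ (μ := chainLaw nbr x)]
        refine measureReal_congr ?_
        filter_upwards [chainLaw_start nbr x] with z hz
        refine propext (iff_of_true (fun i hi => ?_) trivial)
        rwa [Nat.le_zero.1 hi, hz]
      rw [this]
      linarith [h0 x hx]
    | succ k ih =>
      intro x hx
      rcases le_or_gt 1 (f x) with h1 | h1
      · exact (sub_nonpos.2 h1).trans measureReal_nonneg
      obtain ⟨hA, hgen⟩ := hf x hx h1
      have hstep : (chainLaw nbr x).real (S (k + 1)) =
          (chainLaw nbr x).real {ω | (fun k => ω (k + 1)) ∈ S k} := by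
        refine measureReal_congr ?_
        filter_upwards [chainLaw_start nbr x] with z hz
        refine propext ⟨fun h i hi => h (i + 1) (by omega), fun h i hi => ?_⟩
        cases i with
        | zero => rwa [hz]
        | succ i => exact h i (by omega)
      have hc : (0 : ℝ) < (nbr x).card := by exact_mod_cast (hne x hx).card_pos
      have hsum := Finset.sum_le_sum fun y hy => ih y (hA y hy)
      rw [← card_mul_chainLaw_real_shift nbr x (hSm k), ← hstep, Finset.sum_sub_distrib,
        Finset.sum_const, nsmul_one] at hsum
      rw [generator_eq] at hgen
      refine le_of_mul_le_mul_left ?_ hc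
      linarith
  have hlim : Tendsto (fun k => (chainLaw nbr x).real (S k)) atTop
      (𝓝 ((chainLaw nbr x).real (⋂ k, S k))) := by
    refine (ENNReal.tendsto_toReal (measure_ne_top _ _)).comp
      (tendsto_measure_iInter_atTop (fun k => (hSm k).nullMeasurableSet) ?_
        ⟨0, measure_ne_top _ _⟩)
    exact fun k l hkl z hz i hi => hz i (hi.trans hkl)
  refine (ge_of_tendsto' hlim fun k => key k x hx).trans (measureReal_mono fun z hz => ?_)
  exact Eventually.of_forall fun k => Set.mem_iInter.1 hz k k le_rfl

lemma chainLaw_eventually_add_le_one (nbr : V → Finset V) {A B : Set V} (h : Disjoint A B) (x : V) :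
    (chainLaw nbr x).real {z | ∀ᶠ k in atTop, z k ∈ A} +
      (chainLaw nbr x).real {z | ∀ᶠ k in atTop, z k ∈ B} ≤ 1 := by
  rw [← measureReal_union ?_ (measurableSet_eventually_mem B)]
  · exact measureReal_le_one
  · refine Set.disjoint_left.2 fun z hA hB => ?_
    obtain ⟨k, hkA, hkB⟩ := (hA.and hB).exists
    exact Set.disjoint_left.1 h hkA hkB

end FirstStep

/-! ### Nearest neighbours in the lattice. -/

section Lattice

variable {d : ℕ}

/-- The unit vectors `± e_i`. -/
def dir (p : Fin d × Bool) : Site d := Pi.single p.1 (if p.2 then 1 else -1)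

lemma dir_true (i : Fin d) : dir (i, true) = Pi.single i 1 := rfl

lemma dir_false (i : Fin d) : dir (i, false) = -Pi.single i 1 := by
  simp [dir, ← Pi.single_neg]

lemma abs_dir_le (p : Fin d × Bool) (i : Fin d) : |dir p i| ≤ 1 := by
  unfold dir
  rw [Pi.single_apply]
  split_ifs <;> simp

lemma dir_injective : Function.Injective (dir (d := d)) := by
  rintro ⟨i, b⟩ ⟨j, c⟩ h
  have h1 := congrFun h i
  simp only [dir, Pi.single_eq_same, Pi.single_apply] at h1
  by_cases hij : i = j
  · subst hij
    cases b <;> cases c <;> simp_all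
  · rw [if_neg hij] at h1
    cases b <;> simp at h1

lemma exists_dir_of_sum_abs_eq_one {v : Site d} (h : ∑ i, |v i| = 1) : ∃ p, v = dir p := by
  have hex : ∃ i, v i ≠ 0 := by
    by_contra! h0
    simp [h0] at h
  obtain ⟨i, hi⟩ := hex
  have h1 := Finset.add_sum_erase Finset.univ (fun i => |v i|) (Finset.mem_univ i)
  have h2 : 0 ≤ ∑ j ∈ Finset.univ.erase i, |v j| := Finset.sum_nonneg fun _ _ => abs_nonneg _
  have h3 : 1 ≤ |v i| := Int.one_le_abs hi
  have h4 : ∑ j ∈ Finset.univ.erase i, |v j| = 0 := by omega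
  have h5 : |v i| = 1 := by omega
  rw [Finset.sum_eq_zero_iff_of_nonneg (fun _ _ => abs_nonneg _)] at h4
  have h6 : ∀ j, j ≠ i → v j = 0 := fun j hj =>
    abs_eq_zero.1 (h4 j (Finset.mem_erase.2 ⟨hj, Finset.mem_univ j⟩))
  rcases (abs_eq zero_le_one).1 h5 with h7 | h7
  · refine ⟨(i, true), funext fun j => ?_⟩
    by_cases hj : j = i
    · subst hj; simp [dir, h7]
    · simp [dir, hj, h6 j hj]
  · refine ⟨(i, false), funext fun j => ?_⟩
    by_cases hj : j = i
    · subst hj; simp [dir, h7]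
    · simp [dir, hj, h6 j hj]

lemma sum_abs_dir (p : Fin d × Bool) : ∑ i, |dir p i| = 1 := by
  rw [Finset.sum_eq_single p.1]
  · simp only [dir, Pi.single_eq_same]
    split_ifs <;> simp
  · intro j _ hj
    simp [dir, hj]
  · simp

lemma mem_latticeNbrs {x y : Site d} : y ∈ latticeNbrs x ↔ ∃ p, y = x + dir p := by
  rw [latticeNbrs, Finset.mem_filter, Finset.mem_Icc]
  constructor
  · rintro ⟨-, h⟩
    obtain ⟨p, hp⟩ := exists_dir_of_sum_abs_eq_one (v := y - x) h
    exact ⟨p, by rw [← hp]; abel⟩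
  · rintro ⟨p, rfl⟩
    refine ⟨⟨fun i => ?_, fun i => ?_⟩, ?_⟩
    · have := (abs_le.1 (abs_dir_le p i)).1
      simp only [Pi.add_apply]; omega
    · have := (abs_le.1 (abs_dir_le p i)).2
      simp only [Pi.add_apply]; omega
    · simpa using sum_abs_dir p

lemma latticeNbrs_eq_image (x : Site d) :
    latticeNbrs x = Finset.univ.image fun p => x + dir p := by
  ext y
  simp only [mem_latticeNbrs, Finset.mem_image, Finset.mem_univ, true_and, eq_comm]

lemma sum_latticeNbrs (F : Site d → ℝ) (x : Site d) :
    ∑ y ∈ latticeNbrs x, F y = ∑ i, (F (x + Pi.single i 1) + F (x - Pi.single i 1)) := by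
  rw [latticeNbrs_eq_image, Finset.sum_image
    (fun p _ q _ h => dir_injective (add_left_cancel h)), Fintype.sum_prod_type]
  refine Finset.sum_congr rfl fun i _ => ?_
  rw [Fintype.sum_bool, dir_true, dir_false, sub_eq_add_neg]

lemma generator_latticeNbrs (F : Site d → ℝ) (x : Site d) :
    generator latticeNbrs F x =
      ∑ i, (F (x + Pi.single i 1) + F (x + Pi.single i (-1)) - 2 * F x) := by
  rw [generator, sum_latticeNbrs (fun y => F y - F x)]
  refine Finset.sum_congr rfl fun i _ => ?_
  rw [Pi.single_neg, ← sub_eq_add_neg]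
  ring

lemma exists_single_of_mem_latticeNbrs {x y : Site d} (h : y ∈ latticeNbrs x) :
    ∃ (i : Fin d) (a : ℤ), (a = 1 ∨ a = -1) ∧ y = x + Pi.single i a := by
  obtain ⟨⟨i, b⟩, rfl⟩ := mem_latticeNbrs.1 h
  cases b
  · exact ⟨i, -1, Or.inr rfl, rfl⟩
  · exact ⟨i, 1, Or.inl rfl, rfl⟩

lemma card_latticeNbrs_le (x : Site d) : (latticeNbrs x).card ≤ d * 2 := by
  rw [latticeNbrs_eq_image]
  refine Finset.card_image_le.trans ?_
  simp

lemma abs_apply_le_of_mem_latticeNbrs {x y : Site d} (h : y ∈ latticeNbrs x) (i : Fin d) :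
    |y i| ≤ |x i| + 1 := by
  obtain ⟨p, rfl⟩ := mem_latticeNbrs.1 h
  exact (abs_add_le _ _).trans (by have := abs_dir_le p i; omega)

end Lattice

/-! ### Boxes of the domain, harmonicity of `lamFin` and `lam`, and the full setting. -/

section Domain

variable {d : ℕ} [NeZero d] {n : ℕ}

lemma mem_box {N : ℕ} {x : Site d} :
    x ∈ box d n N ↔ (∀ i, |x i| ≤ (N : ℤ)) ∧ x ∈ domain d n := by
  simp only [box, Finset.mem_filter, Finset.mem_Icc, Pi.le_def, abs_le, forall_and]

lemma mem_shell {N : ℕ} {x : Site d} :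
    x ∈ shell d n N ↔ x ∈ box d n (N + 1) ∧ x ∉ box d n N := Finset.mem_sdiff

lemma box_mono {M N : ℕ} (h : M ≤ N) : box d n M ⊆ box d n N := by
  intro x hx
  rw [mem_box] at hx ⊢
  exact ⟨fun i => (hx.1 i).trans (by exact_mod_cast h), hx.2⟩

lemma mem_domain {x : Site d} :
    x ∈ domain d n ↔ (n : ℤ) ≤ x 0 ∨ (∀ i, |x i| ≤ (n : ℤ)) ∨ x 0 ≤ -(n : ℤ) := by
  simp only [domain, rightHalf, channel, leftHalf, Set.mem_union, Set.mem_ofPred_eq, or_assoc]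

lemma mem_domainNbrs {x y : Site d} :
    y ∈ domainNbrs d n x ↔ y ∈ latticeNbrs x ∧ y ∈ domain d n := by
  simp only [domainNbrs, Finset.mem_filter]

lemma mem_finiteNbrs {N : ℕ} {Δ : Finset (Site d)} {x y : Site d} (hx : x ∈ box d n N) :
    y ∈ finiteNbrs d n N Δ x ↔ y ∈ latticeNbrs x ∧ (y ∈ box d n N ∨ y ∈ Δ) := by
  rw [finiteNbrs, if_pos hx, Finset.mem_filter, Finset.mem_union]

lemma finiteNbrs_of_notMem {N : ℕ} {Δ : Finset (Site d)} {x : Site d} (hx : x ∉ box d n N) :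
    finiteNbrs d n N Δ x = ∅ := if_neg hx

lemma card_domainNbrs_le (x : Site d) : (domainNbrs d n x).card ≤ d * 2 :=
  (Finset.card_le_card fun _ hy => (mem_domainNbrs.1 hy).1).trans (card_latticeNbrs_le x)

lemma card_finiteNbrs_le (N : ℕ) (Δ : Finset (Site d)) (x : Site d) :
    (finiteNbrs d n N Δ x).card ≤ d * 2 := by
  unfold finiteNbrs
  split_ifs
  · exact (Finset.card_filter_le _ _).trans (card_latticeNbrs_le x)
  · simp

lemma mem_box_succ_of_mem_domainNbrs {N : ℕ} {x y : Site d} (hx : x ∈ box d n N)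
    (hy : y ∈ domainNbrs d n x) : y ∈ box d n (N + 1) := by
  rw [mem_domainNbrs] at hy
  rw [mem_box] at hx ⊢
  refine ⟨fun i => ?_, hy.2⟩
  have h1 := abs_apply_le_of_mem_latticeNbrs hy.1 i
  have h2 := hx.1 i
  push_cast
  omega

/-- The walk on the domain can always move outwards in the first coordinate, which increases this
function. -/
def depth (n : ℕ) (x : Site d) : ℤ := if -(n : ℤ) < x 0 then x 0 else -x 0

/-- Right of `-n` one can step right: the new site is in the right half, or the old one was inside
the channel. Otherwise one steps left. Only moves along `e1` occur, so the argument remains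
available in the Fick setting. -/
lemma exists_outward {x : Site d} (hx : x ∈ domain d n) :
    (-(n : ℤ) < x 0 ∧ x + e1 d ∈ domainNbrs d n x ∧ depth n x < depth n (x + e1 d)) ∨
      (x 0 ≤ -(n : ℤ) ∧ x - e1 d ∈ domainNbrs d n x ∧ depth n x < depth n (x - e1 d)) := by
  rcases lt_or_ge (-(n : ℤ)) (x 0) with h | h
  · refine Or.inl ⟨h, mem_domainNbrs.2 ⟨mem_latticeNbrs.2 ⟨(0, true), rfl⟩, ?_⟩, ?_⟩
    · rw [mem_domain] at hx ⊢
      by_cases hn : (n : ℤ) ≤ x 0 + 1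
      · left; simpa [e1] using hn
      · right; left
        have hx' : ∀ i, |x i| ≤ (n : ℤ) := by
          rcases hx with hx | hx | hx
          · omega
          · exact hx
          · omega
        intro i
        by_cases hi : i = 0
        · subst hi
          rw [abs_le]
          simp only [e1, Pi.add_apply, Pi.single_eq_same]
          omega
        · simpa [e1, hi] using hx' i
    · simp only [depth, e1, Pi.add_apply, Pi.single_eq_same]
      rw [if_pos h, if_pos (by omega)]
      omega
  · refine Or.inr ⟨h, mem_domainNbrs.2 ⟨mem_latticeNbrs.2 ⟨(0, false), ?_⟩, ?_⟩, ?_⟩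
    · rw [dir_false, sub_eq_add_neg]; rfl
    · rw [mem_domain]
      right; right
      simp only [e1, Pi.sub_apply, Pi.single_eq_same]
      omega
    · simp only [depth, e1, Pi.sub_apply, Pi.single_eq_same]
      rw [if_neg (not_lt.2 h), if_neg (by omega)]
      omega

lemma exists_depth_lt {x : Site d} (hx : x ∈ domain d n) :
    ∃ y ∈ domainNbrs d n x, depth n x < depth n y := by
  rcases exists_outward hx with ⟨-, h⟩ | ⟨-, h⟩
  exacts [⟨_, h⟩, ⟨_, h⟩]

lemma finiteNbrs_shell {N : ℕ} {x : Site d} (hx : x ∈ box d n N) :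
    finiteNbrs d n N (shell d n N) x = domainNbrs d n x := by
  ext y
  rw [mem_finiteNbrs hx]
  constructor
  · rintro ⟨h1, h2 | h2⟩
    · exact mem_domainNbrs.2 ⟨h1, (mem_box.1 h2).2⟩
    · exact mem_domainNbrs.2 ⟨h1, (mem_box.1 (mem_shell.1 h2).1).2⟩
  · intro h
    refine ⟨(mem_domainNbrs.1 h).1, ?_⟩
    by_cases hy : y ∈ box d n N
    · exact Or.inl hy
    · exact Or.inr (mem_shell.2 ⟨mem_box_succ_of_mem_domainNbrs hx h, hy⟩)

/-- Strictly inside the outer box the choice of absorbing sites is invisible, which makes `lamFin`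
harmonic for the infinite walk there. -/
lemma finiteNbrs_eq_domainNbrs {R N : ℕ} (hRN : R < N) {Δ : Finset (Site d)}
    (hΔ : Δ ⊆ shell d n N) {x : Site d} (hx : x ∈ box d n R) :
    finiteNbrs d n N Δ x = domainNbrs d n x := by
  ext y
  rw [mem_finiteNbrs (box_mono hRN.le hx)]
  constructor
  · rintro ⟨h1, h2 | h2⟩
    · exact mem_domainNbrs.2 ⟨h1, (mem_box.1 h2).2⟩
    · exact mem_domainNbrs.2 ⟨h1, (mem_box.1 (mem_shell.1 (hΔ h2)).1).2⟩
  · intro h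
    exact ⟨(mem_domainNbrs.1 h).1, Or.inl (box_mono hRN (mem_box_succ_of_mem_domainNbrs hx h))⟩

lemma lamFin_eq (N : ℕ) (Δ : Finset (Site d)) (σ : Site d → ℝ) (x : Site d) :
    lamFin d n N Δ σ x =
      ∑ y ∈ Δ, σ y * (chainLaw (finiteNbrs d n N Δ) x).real (firstHitAt Δ y) :=
  Finset.sum_congr rfl fun y _ => by rw [walkLaw_real_hitsAt (card_finiteNbrs_le N Δ)]

lemma lamFin_of_mem {N : ℕ} {Δ : Finset (Site d)} (σ : Site d → ℝ) {x : Site d} (hx : x ∈ Δ) :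
    lamFin d n N Δ σ x = σ x := by
  classical
  rw [lamFin_eq, Finset.sum_congr rfl fun y _ => by rw [chainLaw_firstHitAt_of_mem _ hx]]
  simp [hx]

lemma generator_lamFin {N : ℕ} {Δ : Finset (Site d)} (σ : Site d → ℝ) {x : Site d} (hx : x ∉ Δ) :
    generator (finiteNbrs d n N Δ) (lamFin d n N Δ σ) x = 0 := by
  rw [show lamFin d n N Δ σ = fun x => ∑ y ∈ Δ, σ y *
      (chainLaw (finiteNbrs d n N Δ) x).real (firstHitAt Δ y) from funext (lamFin_eq N Δ σ),
    generator_sum]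
  refine Finset.sum_eq_zero fun y _ => ?_
  rw [generator_const_mul, generator_chainLaw_firstHitAt _ y hx, mul_zero]

lemma generator_lamFin_eq_zero {N : ℕ} {Δ : Finset (Site d)} (hΔ : Δ ⊆ shell d n N)
    (σ : Site d → ℝ) (x : Site d) :
    generator (finiteNbrs d n N Δ) (lamFin d n N Δ σ) x = 0 := by
  by_cases hx : x ∈ Δ
  · rw [generator, finiteNbrs_of_notMem (mem_shell.1 (hΔ hx)).2, Finset.sum_empty]
  · exact generator_lamFin σ hx

lemma pPlus_eq : pPlus d n = fun x => (chainLaw (domainNbrs d n) x).real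
    {z | ∀ᶠ k in atTop, z k ∈ rightHalf d n} :=
  funext fun x => walkLaw_real_definitivelyIn card_domainNbrs_le x _

lemma pMinus_eq : pMinus d n = fun x => (chainLaw (domainNbrs d n) x).real
    {z | ∀ᶠ k in atTop, z k ∈ leftHalf d n} :=
  funext fun x => walkLaw_real_definitivelyIn card_domainNbrs_le x _

lemma generator_lam (lm lp : ℝ) (x : Site d) :
    generator (domainNbrs d n) (lam d n lm lp) x = 0 := by
  have : lam d n lm lp = fun x => lm * pMinus d n x + lp * pPlus d n x := rfl
  rw [this, generator_add, generator_const_mul, generator_const_mul, pPlus_eq, pMinus_eq,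
    generator_chainLaw_eventually, generator_chainLaw_eventually]
  simp

lemma generator_congr {V : Type*} {nbr nbr' : V → Finset V} {x : V} (h : nbr x = nbr' x)
    (ψ : V → ℝ) : generator nbr ψ x = generator nbr' ψ x := by
  rw [generator, generator, h]

lemma generator_sub {V : Type*} (nbr : V → Finset V) (ψ φ : V → ℝ) (x : V) :
    generator nbr (fun y => ψ y - φ y) x = generator nbr ψ x - generator nbr φ x := by
  simp only [generator, ← Finset.sum_sub_distrib]
  exact Finset.sum_congr rfl fun y _ => by ring

/-- A harmonic function on a box of the domain is bounded by its values on the shell. -/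
lemma abs_le_of_harmonic_box {N : ℕ} {u : Site d → ℝ} {m : ℝ}
    (hu : ∀ x ∈ box d n N, generator (domainNbrs d n) u x = 0)
    (hm : ∀ y ∈ shell d n N, |u y| ≤ m) : ∀ x ∈ box d n N, |u x| ≤ m :=
  abs_le_of_harmonic (domainNbrs d n) (box d n N) u m (depth n)
    (fun _ hx => exists_depth_lt (mem_box.1 hx).2) hu fun _ hx _ hy hyB =>
      hm _ (mem_shell.2 ⟨mem_box_succ_of_mem_domainNbrs hx hy, hyB⟩)

/-- The difference is harmonic in the box and zero on the shell, so the maximum principle applies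
with bound `0`. -/
lemma lamFin_shell_eq_lam {N : ℕ} {σ : Site d → ℝ} {lm lp : ℝ}
    (hσ : ∀ y ∈ shell d n N, σ y = lam d n lm lp y) {x : Site d} (hx : x ∈ box d n N) :
    lamFin d n N (shell d n N) σ x = lam d n lm lp x := by
  refine sub_eq_zero.1 (abs_nonpos_iff.1 (abs_le_of_harmonic_box
    (u := fun x => lamFin d n N (shell d n N) σ x - lam d n lm lp x) (fun x hx => ?_)
    (fun y hy => ?_) x hx))
  · rw [generator_sub, generator_lam, sub_zero,
      ← generator_congr (finiteNbrs_shell hx), generator_lamFin_eq_zero subset_rfl]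
  · rw [lamFin_of_mem σ hy, hσ y hy, sub_self, abs_zero]

end Domain

/-! ### The profile `u^{-1/4}` and its discrete superharmonicity. -/

section Power

/-- The Taylor coefficient of `t²` is `5/32`; the slack up to `3/16` absorbs the higher terms for
`|t| ≤ 1/16`. After taking fourth powers this slack is the leading `1/8` in `hR`. -/
lemma one_add_rpow_le {t : ℝ} (ht : |t| ≤ 1 / 16) :
    (1 + t) ^ (-(1 / 4) : ℝ) ≤ 1 - t / 4 + 3 / 16 * t ^ 2 := by
  obtain ⟨h1, h2⟩ := abs_le.1 ht
  have hp : 0 < 1 - t / 4 + 3 / 16 * t ^ 2 := by nlinarith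
  have hr : 0 ≤ (1 + t) ^ (-(1 / 4) : ℝ) := Real.rpow_nonneg (by linarith) _
  refine le_of_pow_le_pow_left₀ four_ne_zero hp.le ?_
  have hr4 : ((1 + t) ^ (-(1 / 4) : ℝ)) ^ 4 = (1 + t)⁻¹ := by
    rw [← Real.rpow_natCast, ← Real.rpow_mul (by linarith)]
    norm_num [Real.rpow_neg_one]
  rw [hr4, inv_le_iff_one_le_mul₀ (by linarith)]
  have hsq : 1 - t / 2 + 7 / 16 * t ^ 2 - 3 / 32 * t ^ 3 ≤ (1 - t / 4 + 3 / 16 * t ^ 2) ^ 2 := by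
    nlinarith [sq_nonneg (t ^ 2)]
  have ht2 : 0 ≤ t ^ 2 := sq_nonneg t
  have hr0 : 0 ≤ 1 - t / 2 + 7 / 16 * t ^ 2 - 3 / 32 * t ^ 3 := by nlinarith
  have h4 : (1 - t / 2 + 7 / 16 * t ^ 2 - 3 / 32 * t ^ 3) ^ 2 ≤
      (1 - t / 4 + 3 / 16 * t ^ 2) ^ 4 := by
    calc _ ≤ ((1 - t / 4 + 3 / 16 * t ^ 2) ^ 2) ^ 2 := pow_le_pow_left₀ hr0 hsq 2
      _ = _ := by ring
  have h5 : 1 ≤ (1 - t / 2 + 7 / 16 * t ^ 2 - 3 / 32 * t ^ 3) ^ 2 * (1 + t) := by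
    have hpow : ∀ k, |t ^ k| ≤ (1 / 16) ^ k := fun k => by
      rw [abs_pow]; exact pow_le_pow_left₀ (abs_nonneg t) ht k
    have b2 := (abs_le.1 (hpow 2)).2
    have b3 := (abs_le.1 (hpow 3)).1
    have b4 := (abs_le.1 (hpow 4)).2
    have b5 := (abs_le.1 (hpow 5)).1
    norm_num at b2 b3 b4 b5
    have hR : 0 ≤ 1 / 8 + t / 2 - 87 / 256 * t ^ 2 + 52 / 256 * t ^ 3 - 75 / 1024 * t ^ 4 +
        9 / 1024 * t ^ 5 := by linarith
    have := mul_nonneg ht2 hR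
    linarith
  nlinarith

/-- The decay profile `u ↦ u^{-1/4}`. -/
noncomputable def decay (u : ℝ) : ℝ := u ^ (-(1 / 4) : ℝ)

lemma decay_pos {u : ℝ} (hu : 0 < u) : 0 < decay u := Real.rpow_pos_of_pos hu _

lemma decay_nonneg {u : ℝ} (hu : 0 ≤ u) : 0 ≤ decay u := Real.rpow_nonneg hu _

lemma decay_le {u v : ℝ} (hu : 0 < u) (h : u ≤ v) : decay v ≤ decay u :=
  Real.rpow_le_rpow_of_nonpos hu h (by norm_num)

lemma decay_mul {u v : ℝ} (hu : 0 ≤ u) (hv : 0 ≤ v) : decay (u * v) = decay u * decay v :=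
  Real.mul_rpow hu hv

lemma tendsto_decay : Tendsto decay atTop (𝓝 0) :=
  tendsto_rpow_neg_atTop (by norm_num)

/-- By homogeneity this is a bound at `1 ± b / a`, where the first-order terms cancel. -/
lemma decay_add_add_decay_sub_le {a b : ℝ} (ha : 0 < a) (hb : |b| ≤ a / 16) :
    decay (a + b) + decay (a - b) ≤ decay a * (2 + 3 / 8 * (b ^ 2 / a ^ 2)) := by
  have ht : |b / a| ≤ 1 / 16 := by
    rw [abs_div, abs_of_pos ha, div_le_iff₀ ha]; linarith
  have ht' : |-(b / a)| ≤ 1 / 16 := by rwa [abs_neg]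
  obtain ⟨h1, h2⟩ := abs_le.1 ht
  have e1 : decay (a + b) = decay a * decay (1 + b / a) := by
    rw [← decay_mul ha.le (by linarith)]; congr 1; field_simp
  have e2 : decay (a - b) = decay a * decay (1 + -(b / a)) := by
    rw [← decay_mul ha.le (by linarith)]; congr 1; field_simp; ring
  rw [e1, e2, ← mul_add]
  refine mul_le_mul_of_nonneg_left ?_ (decay_pos ha).le
  have := one_add_rpow_le ht
  have := one_add_rpow_le ht'
  rw [← div_pow]
  simp only [decay]
  linarith [neg_sq (b / a)]

lemma decay_mul_le_decay_sub_one {a : ℝ} (ha : 1 < a) :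
    decay a * (1 + 1 / (4 * a)) ≤ decay (a - 1) := by
  have ha0 : 0 < a := by linarith
  have e : decay (a - 1) = decay a * decay (1 - 1 / a) := by
    have : 0 ≤ 1 - 1 / a := by rw [sub_nonneg, div_le_one ha0]; exact ha.le
    rw [← decay_mul ha0.le this]; congr 1; field_simp
  rw [e]
  refine mul_le_mul_of_nonneg_left ?_ (decay_pos ha0).le
  have hs0 : 0 < 1 / a := by positivity
  have hs1 : 1 / a < 1 := (div_lt_one ha0).2 ha
  have e4 : 1 / (4 * a) = 1 / a / 4 := by field_simp
  rw [e4]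
  set s := 1 / a
  refine le_of_pow_le_pow_left₀ four_ne_zero (decay_nonneg (by linarith)) ?_
  have hr4 : decay (1 - s) ^ 4 = (1 - s)⁻¹ := by
    rw [decay, ← Real.rpow_natCast, ← Real.rpow_mul (by linarith)]
    norm_num [Real.rpow_neg_one]
  have h1s : 0 < 1 - s := by linarith
  rw [hr4, inv_eq_one_div, le_div_iff₀ h1s]
  have := pow_pos hs0 2
  have := pow_pos hs0 3
  have := pow_pos hs0 4
  have := pow_pos hs0 5
  linarith

/-- With `h = δ / a`, one has `(1 + h)^{-1/4} ≥ (1 + h)^{-1} ≥ 1 - h`; the constant `1` in place of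
the sharp `1/4` suffices. -/
lemma decay_sub_decay_add_le {a δ : ℝ} (ha : 0 < a) (hδ : 0 ≤ δ) :
    decay a - decay (a + δ) ≤ decay a / a * δ := by
  have hpos : 0 ≤ δ / a := by positivity
  have e : decay (a + δ) = decay a * decay (1 + δ / a) := by
    rw [← decay_mul ha.le (by linarith)]; congr 1; field_simp
  have h1 : 1 - δ / a ≤ decay (1 + δ / a) := by
    have h2 : (1 + δ / a) ^ (-1 : ℝ) ≤ decay (1 + δ / a) :=
      Real.rpow_le_rpow_of_exponent_le (by linarith) (by norm_num)
    rw [Real.rpow_neg_one] at h2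
    refine le_trans ?_ h2
    rw [inv_eq_one_div, le_div_iff₀ (by linarith)]
    nlinarith
  have := mul_le_mul_of_nonneg_left h1 (decay_pos ha).le
  rw [e]
  have e2 : decay a / a * δ = decay a * (δ / a) := by ring
  rw [e2]
  linarith

/-- Discrete superharmonicity of `(|w|² + 255)^{-1/4}` in dimension at least `3`. -/
lemma sum_decay_le {d : ℕ} (hd : 3 ≤ d) (w : Fin d → ℝ) {Q : ℝ} (hQ : Q = ∑ i, w i ^ 2 + 255) :
    ∑ i, (decay (Q + 1 + 2 * w i) + decay (Q + 1 - 2 * w i) - 2 * decay Q) ≤ 0 := by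
  have hs : 0 ≤ ∑ i, w i ^ 2 := Finset.sum_nonneg fun _ _ => sq_nonneg _
  set a := Q + 1 with ha
  have ha0 : 0 < a := by linarith
  have hD := decay_pos ha0
  have hterm : ∀ i, decay (a + 2 * w i) + decay (a - 2 * w i) - 2 * decay Q ≤
      decay a * (3 / 2 / a ^ 2) * w i ^ 2 - decay a * (1 / (2 * a)) := by
    intro i
    have hi : w i ^ 2 ≤ ∑ i, w i ^ 2 :=
      Finset.single_le_sum (f := fun i => w i ^ 2) (fun _ _ => sq_nonneg _) (Finset.mem_univ i)
    -- This fixes the constant `255`: then `a ≥ |w i|² + 256 ≥ 32 |w i|`, by expanding `(|w i| -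
    -- 16)²`.
    have h1 : |2 * w i| ≤ a / 16 := by
      rw [abs_mul, abs_two]
      nlinarith [sq_nonneg (|w i| - 16), sq_abs (w i)]
    have h2 := decay_add_add_decay_sub_le ha0 h1
    have h3 := decay_mul_le_decay_sub_one (a := a) (by linarith)
    rw [show a - 1 = Q by rw [ha]; ring] at h3
    have e1 : decay a * (2 + 3 / 8 * ((2 * w i) ^ 2 / a ^ 2)) =
        2 * decay a + decay a * (3 / 2 / a ^ 2) * w i ^ 2 := by ring
    have e2 : decay a * (1 + 1 / (4 * a)) = decay a + decay a * (1 / (2 * a)) / 2 := by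
      field_simp; ring
    linarith
  refine (Finset.sum_le_sum fun i _ => hterm i).trans ?_
  rw [Finset.sum_sub_distrib, ← Finset.mul_sum, Finset.sum_const, Finset.card_univ,
    Fintype.card_fin, nsmul_eq_mul]
  have hd' : (3 : ℝ) ≤ d := by exact_mod_cast hd
  -- The dimension enters here: the bracket is nonpositive because `d ≥ 3` and `a` exceeds the sum
  -- of squares.
  have e : decay a * (3 / 2 / a ^ 2) * ∑ i, w i ^ 2 - d * (decay a * (1 / (2 * a))) =
      decay a / (2 * a ^ 2) * (3 * ∑ i, w i ^ 2 - d * a) := by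
    field_simp
  rw [e]
  refine mul_nonpos_of_nonneg_of_nonpos (by positivity) ?_
  nlinarith

end Power

/-! ### Barriers adapted to the wall and to the lateral sides. -/

section Barrier

variable {d : ℕ} [NeZero d]

/-- The half lattice `{x : s x₁ ≥ n}`, for a sign `s`. -/
def half (s : ℤ) (n : ℕ) : Set (Site d) := {x | (n : ℤ) ≤ s * x 0}

lemma half_one (n : ℕ) : half 1 n = rightHalf d n := by
  ext x; simp [half, rightHalf]

lemma half_neg_one (n : ℕ) : half (-1) n = leftHalf d n := by
  ext x; simp only [half, leftHalf, Set.mem_ofPred_eq]; omega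

/-- Coordinates relative to the centre of reflection in the wall of the half lattice. -/
noncomputable def wallCoord (s : ℤ) (n : ℕ) (x : Site d) (i : Fin d) : ℝ :=
  if i = 0 then s * x 0 - n + 1 / 2 else x i

/-- The shifted squared distance to the centre of the mouth of the channel. -/
noncomputable def mouthDist (s : ℤ) (n : ℕ) (x : Site d) : ℝ := ∑ i, wallCoord s n x i ^ 2 + 255

/-- The barrier of the infinite domain. -/
noncomputable def barrier (s : ℤ) (n : ℕ) (x : Site d) : ℝ := decay (mouthDist s n x)

/-- A discrete harmonic quadratic with positive outward derivative at the lateral sides of the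
box. -/
noncomputable def lateral (s : ℤ) (n N : ℕ) (x : Site d) : ℝ :=
  -- The squares contribute `2 d` to the discrete Laplacian and the term in coordinate `0` removes
  -- it; the constant makes the function nonnegative in the box.
  ∑ i, wallCoord s n x i ^ 2 - d * wallCoord s n x 0 ^ 2 + d * (N + 1) ^ 2

/-- The barrier of the finite box. -/
noncomputable def boxBarrier (s : ℤ) (n N : ℕ) (x : Site d) : ℝ :=
  -- The coefficient dominates the slope of the profile at squared distance `N ^ 2`, while the whole
  -- correction is only of order `decay (N ^ 2)`.
  barrier s n x + decay (N ^ 2) / N ^ 2 * lateral s n N x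

/-- The sign of the dependence of a wall coordinate on the corresponding lattice coordinate. -/
def wallSign (s : ℤ) (i : Fin d) : ℝ := if i = 0 then s else 1

lemma mouthDist_pos (s : ℤ) (n : ℕ) (x : Site d) : 0 < mouthDist s n x := by
  have : 0 ≤ ∑ i, wallCoord s n x i ^ 2 := Finset.sum_nonneg fun _ _ => sq_nonneg _
  unfold mouthDist
  linarith

lemma barrier_pos (s : ℤ) (n : ℕ) (x : Site d) : 0 < barrier s n x := decay_pos (mouthDist_pos s n x)

lemma wallCoord_add_single (s : ℤ) (n : ℕ) (x : Site d) (i j : Fin d) (a : ℤ) :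
    wallCoord s n (x + Pi.single i a) j =
      wallCoord s n x j + if j = i then wallSign s i * a else 0 := by
  unfold wallCoord wallSign
  by_cases hj : j = 0
  · subst hj
    by_cases hi : i = 0
    · subst hi
      simp
      ring
    · simp [Ne.symm hi]
  · by_cases hi : j = i
    · subst hi
      simp [hj]
    · simp [hj, hi]

lemma sum_wallCoord_sq_add_single {s : ℤ} (hs : s = 1 ∨ s = -1) (n : ℕ) (x : Site d) (i : Fin d)
    {a : ℤ} (ha : a = 1 ∨ a = -1) :
    ∑ j, wallCoord s n (x + Pi.single i a) j ^ 2 =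
      ∑ j, wallCoord s n x j ^ 2 + 1 + 2 * a * wallSign s i * wallCoord s n x i := by
  have hsg : wallSign s i ^ 2 = 1 := by
    unfold wallSign
    split_ifs
    · rcases hs with rfl | rfl <;> norm_num
    · norm_num
  have ha2 : (a : ℝ) ^ 2 = 1 := by rcases ha with rfl | rfl <;> norm_num
  have : ∀ j, wallCoord s n (x + Pi.single i a) j ^ 2 = wallCoord s n x j ^ 2 +
      if j = i then 1 + 2 * a * wallSign s i * wallCoord s n x i else 0 := by
    intro j
    rw [wallCoord_add_single]
    split_ifs with h
    · subst h
      rw [add_sq, mul_pow, hsg, ha2]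
      ring
    · ring
  rw [Finset.sum_congr rfl fun j _ => this j, Finset.sum_add_distrib, Finset.sum_ite_eq',
    if_pos (Finset.mem_univ i)]
  ring

lemma mouthDist_add_single {s : ℤ} (hs : s = 1 ∨ s = -1) (n : ℕ) (x : Site d) (i : Fin d)
    {a : ℤ} (ha : a = 1 ∨ a = -1) :
    mouthDist s n (x + Pi.single i a) =
      mouthDist s n x + 1 + 2 * a * wallSign s i * wallCoord s n x i := by
  rw [mouthDist, sum_wallCoord_sq_add_single hs n x i ha, mouthDist]
  ring

lemma generator_latticeNbrs_barrier (hd : 3 ≤ d) {s : ℤ} (hs : s = 1 ∨ s = -1) (n : ℕ)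
    (x : Site d) : generator latticeNbrs (barrier s n) x ≤ 0 := by
  rw [generator_latticeNbrs]
  refine le_trans (le_of_eq (Finset.sum_congr rfl fun i _ => ?_))
    (sum_decay_le hd (fun i => wallSign s i * wallCoord s n x i) (Q := mouthDist s n x) ?_)
  · simp only [barrier, mouthDist_add_single hs n x i (Or.inl rfl),
      mouthDist_add_single hs n x i (Or.inr rfl)]
    push_cast
    congr 3 <;> ring
  · unfold mouthDist
    congr 1
    refine Finset.sum_congr rfl fun i _ => ?_
    have hsg : wallSign s i ^ 2 = 1 := by
      unfold wallSign
      split_ifs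
      · rcases hs with rfl | rfl <;> norm_num
      · norm_num
    rw [mul_pow, hsg, one_mul]

lemma generator_latticeNbrs_lateral {s : ℤ} (hs : s = 1 ∨ s = -1) (n N : ℕ)
    (x : Site d) : generator latticeNbrs (lateral s n N) x = 0 := by
  rw [generator_latticeNbrs]
  have : ∀ i, lateral s n N (x + Pi.single i 1) + lateral s n N (x + Pi.single i (-1)) -
      2 * lateral s n N x = 2 - if i = 0 then 2 * (d : ℝ) else 0 := by
    intro i
    unfold lateral
    rw [sum_wallCoord_sq_add_single hs n x i (Or.inl rfl),
      sum_wallCoord_sq_add_single hs n x i (Or.inr rfl), wallCoord_add_single,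
      wallCoord_add_single]
    by_cases hi : i = 0
    · subst hi
      have hsg : (s : ℝ) ^ 2 = 1 := by rcases hs with rfl | rfl <;> norm_num
      simp only [wallSign, if_true]
      push_cast
      linear_combination (-2 * (d : ℝ)) * hsg
    · simp only [hi, Ne.symm hi, if_false]
      push_cast
      ring
  rw [Finset.sum_congr rfl fun i _ => this i, Finset.sum_sub_distrib, Finset.sum_ite_eq',
    if_pos (Finset.mem_univ _)]
  simp
  ring

/-- Superharmonicity on the full lattice passes to a walk with suppressed moves if the function does
not decrease along them. -/
lemma generator_le_generator_of_subset {V : Type*} {nbr nbr' : V → Finset V} {F : V → ℝ} {x : V}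
    (h : nbr x ⊆ nbr' x) (hF : ∀ y ∈ nbr' x, y ∉ nbr x → F x ≤ F y) :
    generator nbr F x ≤ generator nbr' F x :=
  Finset.sum_le_sum_of_subset_of_nonneg h fun y hy hy' => sub_nonneg.2 (hF y hy hy')

lemma generator_latticeNbrs_boxBarrier (hd : 3 ≤ d) {s : ℤ} (hs : s = 1 ∨ s = -1) (n N : ℕ)
    (x : Site d) : generator latticeNbrs (boxBarrier s n N) x ≤ 0 := by
  have : boxBarrier s n N = fun x : Site d =>
    barrier s n x + decay (N ^ 2) / N ^ 2 * lateral s n N x := rfl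
  rw [this, generator_add, generator_const_mul, generator_latticeNbrs_lateral hs, mul_zero,
    add_zero]
  exact generator_latticeNbrs_barrier hd hs n x

/-- Reflection in the wall. -/
lemma wallCoord_sq_reflect {s : ℤ} (hs : s = 1 ∨ s = -1) {n : ℕ} {x : Site d}
    (hx : s * x 0 = n) (i : Fin d) :
    wallCoord s n (x + Pi.single 0 (-s)) i ^ 2 = wallCoord s n x i ^ 2 := by
  rw [wallCoord_add_single]
  split_ifs with hi
  · subst hi
    have hx' : (s : ℝ) * x 0 = n := by exact_mod_cast hx
    -- The half-integer offset makes the coordinate `1/2` at the wall and `-1/2` one step behind it.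
    simp only [wallCoord, wallSign, if_true, hx']
    rcases hs with rfl | rfl <;> norm_num
  · simp

lemma barrier_reflect {s : ℤ} (hs : s = 1 ∨ s = -1) {n : ℕ} {x : Site d} (hx : s * x 0 = n) :
    barrier s n (x + Pi.single 0 (-s)) = barrier s n x := by
  simp only [barrier, mouthDist, wallCoord_sq_reflect hs hx]

lemma boxBarrier_reflect {s : ℤ} (hs : s = 1 ∨ s = -1) {n : ℕ} (N : ℕ) {x : Site d}
    (hx : s * x 0 = n) :
    boxBarrier s n N (x + Pi.single 0 (-s)) = boxBarrier s n N x := by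
  simp only [boxBarrier, lateral, barrier_reflect hs hx, wallCoord_sq_reflect hs hx]

/-- The box barrier does not decrease across the lateral sides of the box. -/
lemma boxBarrier_le_lateral {s : ℤ} (hs : s = 1 ∨ s = -1) {n N : ℕ} (hN : 1 ≤ N) {x : Site d}
    {i : Fin d} (hi : i ≠ 0) {a : ℤ} (ha : a = 1 ∨ a = -1) (hx : a * x i = N) :
    boxBarrier s n N x ≤ boxBarrier s n N (x + Pi.single i a) := by
  have hN0 : (0 : ℝ) < N := by exact_mod_cast hN
  have hx' : (a : ℝ) * x i = N := by exact_mod_cast hx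
  have hw : 2 * (a : ℝ) * wallSign s i * wallCoord s n x i = 2 * N := by
    simp only [wallSign, wallCoord, if_neg hi]
    rw [← hx']; ring
  have h1 : mouthDist s n (x + Pi.single i a) = mouthDist s n x + (1 + 2 * N) := by
    rw [mouthDist_add_single hs n x i ha, hw]; ring
  have h2 : lateral s n N (x + Pi.single i a) = lateral s n N x + (1 + 2 * N) := by
    unfold lateral
    rw [sum_wallCoord_sq_add_single hs n x i ha, hw, wallCoord_add_single, if_neg (Ne.symm hi)]
    ring
  have hQ : (N : ℝ) ^ 2 ≤ mouthDist s n x := by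
    have h3 : wallCoord s n x i ^ 2 ≤ ∑ j, wallCoord s n x j ^ 2 :=
      Finset.single_le_sum (f := fun j => wallCoord s n x j ^ 2) (fun _ _ => sq_nonneg _)
        (Finset.mem_univ i)
    have h4 : wallCoord s n x i ^ 2 = (N : ℝ) ^ 2 := by
      have ha2 : (a : ℝ) ^ 2 = 1 := by rcases ha with rfl | rfl <;> norm_num
      simp only [wallCoord, if_neg hi]
      rw [← hx', mul_pow, ha2, one_mul]
    unfold mouthDist
    linarith
  have hpos : (0 : ℝ) < N ^ 2 := by positivity
  have h5 := decay_sub_decay_add_le (mouthDist_pos s n x) (δ := 1 + 2 * (N : ℝ)) (by positivity)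
  -- Over the same increment `1 + 2 N`, the loss of the barrier is thus at most the gain of the
  -- lateral term.
  have h6 : decay (mouthDist s n x) / mouthDist s n x ≤ decay (N ^ 2) / N ^ 2 :=
    div_le_div₀ (decay_pos hpos).le (decay_le hpos hQ) hpos hQ
  have h7 := mul_le_mul_of_nonneg_right h6 (by positivity : (0 : ℝ) ≤ 1 + 2 * N)
  simp only [boxBarrier, barrier, h1, h2]
  linarith

end Barrier

/-! ### Comparison with the barriers and convergence in the Fick setting. -/

section Fick

variable {d n N : ℕ} {s : ℤ}

lemma mem_channel {x : Site d} : x ∈ channel d n ↔ ∀ i, |x i| ≤ (n : ℤ) := Iff.rfl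

/-- A lower bound for the barrier at the mouth of the channel. -/
noncomputable def mouthLevel (d n : ℕ) : ℝ := decay (d * (n ^ 2 + 1) + 255)

lemma mouthLevel_pos : 0 < mouthLevel d n := decay_pos (by positivity)

variable [NeZero d]

lemma mem_half {x : Site d} : x ∈ half s n ↔ (n : ℤ) ≤ s * x 0 := Iff.rfl

lemma mem_domain_of_mem_half (hs : s = 1 ∨ s = -1) {x : Site d} (hx : x ∈ half s n) :
    x ∈ domain d n := by
  rw [mem_half] at hx
  rw [mem_domain]
  rcases hs with rfl | rfl <;> omega

lemma exists_mem_half {x : Site d} (hx : x ∈ domain d n) (hc : x ∉ channel d n) :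
    x ∈ half 1 n ∨ x ∈ half (-1) n := by
  rcases mem_domain.1 hx with h | h | h
  · left; rw [mem_half]; omega
  · exact absurd h hc
  · right; rw [mem_half]; omega

/-- One leaves a half lattice only through the mouth of the channel. -/
lemma mem_half_of_mem_domainNbrs (hn : 1 ≤ n) (hs : s = 1 ∨ s = -1) {x y : Site d}
    (hx : x ∈ half s n) (hc : x ∉ channel d n) (hy : y ∈ domainNbrs d n x) : y ∈ half s n := by
  obtain ⟨hy, hyd⟩ := mem_domainNbrs.1 hy
  obtain ⟨i, a, ha, rfl⟩ := exists_single_of_mem_latticeNbrs hy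
  by_contra hlt
  rw [mem_half] at hx hlt
  by_cases hi : i = 0
  · subst hi
    simp only [Pi.add_apply, Pi.single_eq_same] at hlt
    have hch : ∀ j, |(x + Pi.single 0 a : Site d) j| ≤ (n : ℤ) := by
      rcases mem_domain.1 hyd with h | h | h
      · simp only [Pi.add_apply, Pi.single_eq_same] at h
        rcases hs with rfl | rfl <;> rcases ha with rfl | rfl <;> omega
      · exact h
      · simp only [Pi.add_apply, Pi.single_eq_same] at h
        rcases hs with rfl | rfl <;> rcases ha with rfl | rfl <;> omega
    refine hc (mem_channel.2 fun j => ?_)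
    by_cases hj : j = 0
    · subst hj
      rw [abs_le]
      rcases hs with rfl | rfl <;> rcases ha with rfl | rfl <;> omega
    · simpa [hj] using hch j
  · simp [Ne.symm hi] at hlt
    omega

lemma mouthLevel_le_barrier (hs : s = 1 ∨ s = -1) {x : Site d} (hx : x ∈ half s n)
    (hc : x ∈ channel d n) : mouthLevel d n ≤ barrier s n x := by
  refine decay_le (mouthDist_pos s n x) (add_le_add_left ?_ _)
  have h : ∀ i ∈ Finset.univ, wallCoord s n x i ^ 2 ≤ (n : ℝ) ^ 2 + 1 := by
    intro i _
    unfold wallCoord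
    split_ifs with hi
    · have h0 := hc 0
      have : s * x 0 = n := by
        rw [mem_half] at hx
        rw [abs_le] at h0
        rcases hs with rfl | rfl <;> omega
      have : (s : ℝ) * x 0 = n := by exact_mod_cast this
      rw [this]
      nlinarith [sq_nonneg (n : ℝ)]
    · have h0 : |(x i : ℝ)| ≤ n := by exact_mod_cast hc i
      have := sq_le_sq' (abs_le.1 h0).1 (abs_le.1 h0).2
      linarith
  refine (Finset.sum_le_sum h).trans (le_of_eq ?_)
  rw [Finset.sum_const, Finset.card_univ, Fintype.card_fin, nsmul_eq_mul]

/-- The only suppressed move from a half lattice is the one to the mirror image in the wall, where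
the barriers take the same value. -/
lemma exists_eq_reflect {x : Site d} (hs : s = 1 ∨ s = -1) (hx : x ∈ half s n)
    {y : Site d} (hy : y ∈ latticeNbrs x) (hyd : y ∉ domain d n) :
    s * x 0 = n ∧ y = x + Pi.single 0 (-s) := by
  obtain ⟨i, a, ha, rfl⟩ := exists_single_of_mem_latticeNbrs hy
  have hyh : x + Pi.single i a ∉ half s n := fun h => hyd (mem_domain_of_mem_half hs h)
  rw [mem_half] at hx hyh
  by_cases hi : i = 0
  · subst hi
    simp only [Pi.add_apply, Pi.single_eq_same] at hyh
    have : a = -s := by rcases hs with rfl | rfl <;> rcases ha with rfl | rfl <;> omega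
    subst this
    refine ⟨?_, rfl⟩
    rcases hs with rfl | rfl <;> omega
  · simp [Ne.symm hi] at hyh
    omega

/-- Dividing the barrier by `mouthLevel` makes it at least `1` at the mouth, the only exit;
elsewhere in the half lattice it is superharmonic for the domain walk by reflection. -/
lemma one_sub_le_chainLaw_half (hd : 3 ≤ d) (hn : 1 ≤ n) (hs : s = 1 ∨ s = -1) {x : Site d}
    (hx : x ∈ half s n) :
    1 - (mouthLevel d n)⁻¹ * barrier s n x ≤
      (chainLaw (domainNbrs d n) x).real {z | ∀ᶠ k in atTop, z k ∈ half (d := d) s n} := by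
  have hm := mouthLevel_pos (d := d) (n := n)
  refine one_sub_le_chainLaw_eventually (domainNbrs d n) (half s n)
    (fun x => (mouthLevel d n)⁻¹ * barrier s n x)
    (fun x _ => mul_nonneg (inv_nonneg.2 hm.le) (barrier_pos s n x).le) (fun x hx => ?_)
    (fun x hx hlt => ?_) hx
  · obtain ⟨y, hy, -⟩ := exists_depth_lt (mem_domain_of_mem_half hs hx)
    exact ⟨y, hy⟩
  · have hc : x ∉ channel d n := by
      intro hc
      rw [inv_mul_lt_iff₀ hm, mul_one] at hlt
      exact absurd (mouthLevel_le_barrier hs hx hc) (not_le.2 hlt)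
    refine ⟨fun y hy => mem_half_of_mem_domainNbrs hn hs hx hc hy, ?_⟩
    rw [generator_const_mul]
    refine mul_nonpos_of_nonneg_of_nonpos (inv_nonneg.2 hm.le) (le_trans ?_
      (generator_latticeNbrs_barrier hd hs n x))
    refine generator_le_generator_of_subset (fun y hy => (mem_domainNbrs.1 hy).1) fun y hy hy' => ?_
    obtain ⟨h1, rfl⟩ := exists_eq_reflect hs hx hy fun h => hy' (mem_domainNbrs.2 ⟨hy, h⟩)
    exact (barrier_reflect hs h1).ge

lemma disjoint_halves (hn : 1 ≤ n) : Disjoint (rightHalf d n) (leftHalf d n) := by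
  refine Set.disjoint_left.2 fun x h1 h2 => ?_
  simp only [rightHalf, leftHalf, Set.mem_ofPred_eq] at h1 h2
  omega

lemma pPlus_add_pMinus_le_one (hn : 1 ≤ n) (x : Site d) : pPlus d n x + pMinus d n x ≤ 1 := by
  rw [pPlus_eq, pMinus_eq]
  exact chainLaw_eventually_add_le_one _ (disjoint_halves hn) x

lemma pPlus_nonneg (x : Site d) : 0 ≤ pPlus d n x := measureReal_nonneg

lemma pMinus_nonneg (x : Site d) : 0 ≤ pMinus d n x := measureReal_nonneg

/-- The boundary value on the side of sign `s`. -/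
def sideValue (lm lp : ℝ) (s : ℤ) : ℝ := if s = 1 then lp else lm

/-- The probability of ending on side `s` is nearly `1`, and since the half lattices are disjoint
the other probability is at most the deficit. -/
lemma abs_lam_sub_le (hd : 3 ≤ d) (hn : 1 ≤ n) (hs : s = 1 ∨ s = -1) (lm lp : ℝ) {x : Site d}
    (hx : x ∈ half s n) :
    |lam d n lm lp x - sideValue lm lp s| ≤
      (|lm| + |lp|) * ((mouthLevel d n)⁻¹ * barrier s n x) := by
  have h1 := one_sub_le_chainLaw_half hd hn hs hx
  have h2 := pPlus_add_pMinus_le_one hn x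
  have h3 := pPlus_nonneg (n := n) x
  have h4 := pMinus_nonneg (n := n) x
  set η := (mouthLevel d n)⁻¹ * barrier s n x
  have key : ∀ {l l' p p' : ℝ}, 0 ≤ p' → p + p' ≤ 1 → 1 - η ≤ p →
      |l' * p' + l * p - l| ≤ (|l'| + |l|) * η := by
    intro l l' p p' hp' hpp h
    have e : l' * p' + l * p - l = l' * p' + l * (p - 1) := by ring
    rw [e, add_mul]
    refine (abs_add_le _ _).trans (add_le_add ?_ ?_)
    · rw [abs_mul, abs_of_nonneg hp']
      exact mul_le_mul_of_nonneg_left (by linarith) (abs_nonneg _)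
    · rw [abs_mul, abs_of_nonpos (by linarith : p - 1 ≤ 0)]
      exact mul_le_mul_of_nonneg_left (by linarith) (abs_nonneg _)
  rcases hs with rfl | rfl
  · rw [half_one] at h1
    have h5 : 1 - η ≤ pPlus d n x := by rw [pPlus_eq]; exact h1
    simpa [sideValue, lam] using key (l := lp) (l' := lm) h4 h2 h5
  · rw [half_neg_one] at h1
    have h5 : 1 - η ≤ pMinus d n x := by rw [pMinus_eq]; exact h1
    have h6 := key (l := lm) (l' := lp) h3 (by linarith) h5
    rw [add_comm |lm|]
    simpa [sideValue, lam, add_comm] using h6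

/-- The absorbing sites of the Fick setting. -/
noncomputable def faces (d n N : ℕ) [NeZero d] : Finset (Site d) := rightFace d n N ∪ leftFace d n N

lemma faces_subset_shell : faces d n N ⊆ shell d n N :=
  Finset.union_subset (Finset.filter_subset _ _) (Finset.filter_subset _ _)

lemma eq_zero_coord_of_mem_shell {y : Site d} (hy : y ∈ shell d n N)
    (h : ∀ i, i ≠ 0 → |y i| ≤ (N : ℤ)) : |y 0| = N + 1 := by
  obtain ⟨h1, h2⟩ := mem_shell.1 hy
  have h3 := (mem_box.1 h1).1 0
  push_cast at h3
  refine le_antisymm h3 (not_lt.1 fun hlt => h2 (mem_box.2 ⟨fun i => ?_, (mem_box.1 h1).2⟩))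
  by_cases hi : i = 0
  · subst hi; omega
  · exact h i hi

lemma apply_zero_of_mem_rightFace {y : Site d} (hy : y ∈ rightFace d n N) : y 0 = N + 1 := by
  obtain ⟨h1, h2⟩ := Finset.mem_filter.1 hy
  have h3 := eq_zero_coord_of_mem_shell h1 fun i hi => by
    simpa [e1, hi] using (mem_box.1 h2).1 i
  have h4 := (mem_box.1 h2).1 0
  simp only [e1, Pi.sub_apply, Pi.single_eq_same] at h4
  rcases (abs_eq (by positivity)).1 h3 with h | h
  · exact h
  · rw [h, abs_le] at h4; omega

lemma apply_zero_of_mem_leftFace {y : Site d} (hy : y ∈ leftFace d n N) : y 0 = -(N + 1) := by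
  obtain ⟨h1, h2⟩ := Finset.mem_filter.1 hy
  have h3 := eq_zero_coord_of_mem_shell h1 fun i hi => by
    simpa [e1, hi] using (mem_box.1 h2).1 i
  have h4 := (mem_box.1 h2).1 0
  simp only [e1, Pi.add_apply, Pi.single_eq_same] at h4
  rcases (abs_eq (by positivity)).1 h3 with h | h
  · rw [h, abs_le] at h4; omega
  · exact h

/-- A move along the first axis that leaves the box lands on a face, so it is never suppressed; the
maximum principle through `depth` therefore persists. -/
lemma mem_finiteNbrs_faces_of_single_zero {x : Site d} (hx : x ∈ box d n N) {a : ℤ}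
    (ha : a = 1 ∨ a = -1) (hy : x + Pi.single 0 a ∈ domainNbrs d n x) :
    x + Pi.single 0 a ∈ finiteNbrs d n N (faces d n N) x := by
  rw [mem_finiteNbrs hx]
  refine ⟨(mem_domainNbrs.1 hy).1, ?_⟩
  by_cases hB : x + Pi.single 0 a ∈ box d n N
  · exact Or.inl hB
  · right
    have hsh := mem_shell.2 ⟨mem_box_succ_of_mem_domainNbrs hx hy, hB⟩
    rcases ha with rfl | rfl
    · exact Finset.mem_union_left _ (Finset.mem_filter.2 ⟨hsh, by simpa [e1] using hx⟩)
    · refine Finset.mem_union_right _ (Finset.mem_filter.2 ⟨hsh, ?_⟩)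
      simpa [e1, Pi.single_neg] using hx

lemma exists_depth_lt_faces {x : Site d} (hx : x ∈ box d n N) :
    ∃ y ∈ finiteNbrs d n N (faces d n N) x, depth n x < depth n y := by
  rcases exists_outward (mem_box.1 hx).2 with ⟨-, h1, h2⟩ | ⟨-, h1, h2⟩
  · exact ⟨_, mem_finiteNbrs_faces_of_single_zero hx (Or.inl rfl) h1, h2⟩
  · have e : x - e1 d = x + Pi.single 0 (-1) := by rw [e1, Pi.single_neg, sub_eq_add_neg]
    rw [e] at h1 h2
    exact ⟨_, mem_finiteNbrs_faces_of_single_zero hx (Or.inr rfl) h1, h2⟩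

lemma finiteNbrs_faces_subset {x : Site d} (hx : x ∈ box d n N) :
    finiteNbrs d n N (faces d n N) x ⊆ domainNbrs d n x := by
  intro y hy
  rw [← finiteNbrs_shell hx, mem_finiteNbrs hx]
  rw [mem_finiteNbrs hx] at hy
  exact ⟨hy.1, hy.2.imp id fun h => faces_subset_shell h⟩

lemma abs_lamFin_sub_le {σ : Site d → ℝ} {l m : ℝ} (hσ : ∀ y ∈ faces d n N, |σ y - l| ≤ m)
    {x : Site d} (hx : x ∈ box d n N) : |lamFin d n N (faces d n N) σ x - l| ≤ m := by
  refine abs_le_of_harmonic (finiteNbrs d n N (faces d n N)) (box d n N)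
    (fun x => lamFin d n N (faces d n N) σ x - l) m (depth n)
    (fun x hx => exists_depth_lt_faces hx) (fun x hx => ?_) (fun x hx y hy hyB => ?_) x hx
  · rw [generator_sub, generator_const, generator_lamFin_eq_zero faces_subset_shell, sub_zero]
  · have hy' := ((mem_finiteNbrs hx).1 hy).2.resolve_left hyB
    rw [lamFin_of_mem σ hy']
    exact hσ y hy'

lemma lateral_nonneg (hn : 1 ≤ n) {x : Site d} (hx : x ∈ half s n) (hN : s * x 0 ≤ N + 1) :
    0 ≤ lateral s n N x := by
  rw [mem_half] at hx
  have hx' : (n : ℝ) ≤ s * x 0 := by exact_mod_cast hx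
  have hN' : (s : ℝ) * x 0 ≤ N + 1 := by exact_mod_cast hN
  have hn' : (1 : ℝ) ≤ n := by exact_mod_cast hn
  have h1 : wallCoord s n x 0 ^ 2 ≤ ((N : ℝ) + 1) ^ 2 := by
    simp only [wallCoord, if_true]
    exact pow_le_pow_left₀ (by linarith) (by linarith) 2
  have h2 := mul_le_mul_of_nonneg_left h1 (Nat.cast_nonneg d : (0 : ℝ) ≤ d)
  have h3 : 0 ≤ ∑ i, wallCoord s n x i ^ 2 := Finset.sum_nonneg fun _ _ => sq_nonneg _
  unfold lateral
  linarith

lemma lateralFactor_nonneg (N : ℕ) : 0 ≤ decay ((N : ℝ) ^ 2) / (N : ℝ) ^ 2 :=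
  div_nonneg (decay_nonneg (sq_nonneg _)) (sq_nonneg _)

lemma barrier_le_boxBarrier (hn : 1 ≤ n) {x : Site d} (hx : x ∈ half s n)
    (hN : s * x 0 ≤ N + 1) : barrier s n x ≤ boxBarrier s n N x :=
  le_add_of_nonneg_right (mul_nonneg (lateralFactor_nonneg N) (lateral_nonneg hn hx hN))

lemma boxBarrier_le (hn : 1 ≤ n) (hs : s = 1 ∨ s = -1) (hN : 1 ≤ N) {x : Site d}
    (hx : x ∈ half s n) (hxN : x ∈ box d n N) :
    boxBarrier s n N x ≤ barrier s n x + 8 * d * decay ((N : ℝ) ^ 2) := by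
  have hN' : (1 : ℝ) ≤ N := by exact_mod_cast hN
  have hw : ∀ i ∈ Finset.univ, wallCoord s n x i ^ 2 ≤ ((N : ℝ) + 1) ^ 2 := by
    intro i _
    have hi : |(x i : ℝ)| ≤ N := by exact_mod_cast (mem_box.1 hxN).1 i
    rw [abs_le] at hi
    unfold wallCoord
    split_ifs with h0
    · subst h0
      rw [mem_half] at hx
      have hx' : (n : ℝ) ≤ s * x 0 := by exact_mod_cast hx
      have hn' : (1 : ℝ) ≤ n := by exact_mod_cast hn
      have : (s : ℝ) * x 0 ≤ N := by
        rcases hs with rfl | rfl <;> push_cast <;> linarith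
      exact pow_le_pow_left₀ (by linarith) (by linarith) 2
    · exact sq_le_sq' (by linarith) (by linarith)
  have hsum := Finset.sum_le_sum hw
  rw [Finset.sum_const, Finset.card_univ, Fintype.card_fin, nsmul_eq_mul] at hsum
  have hd0 : (0 : ℝ) ≤ d := Nat.cast_nonneg d
  have hlat : lateral s n N x ≤ 8 * d * (N : ℝ) ^ 2 := by
    have h0 : 0 ≤ d * wallCoord s n x 0 ^ 2 := by positivity
    -- The constant `8 d` below is `2 d`, from the sum of squares and the additive term, times this
    -- `4`.
    have h1 : ((N : ℝ) + 1) ^ 2 ≤ 4 * (N : ℝ) ^ 2 := by nlinarith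
    have h2 := mul_le_mul_of_nonneg_left h1 hd0
    unfold lateral
    linarith
  have := mul_le_mul_of_nonneg_left hlat (lateralFactor_nonneg N)
  have e : decay ((N : ℝ) ^ 2) / (N : ℝ) ^ 2 * (8 * d * (N : ℝ) ^ 2) =
      8 * d * decay ((N : ℝ) ^ 2) := by
    field_simp
  unfold boxBarrier
  linarith

/-- A suppressed neighbour either lies behind the wall, where reflection gives equality, or in the
domain beyond a lateral side, where the barrier does not decrease. -/
lemma generator_boxBarrier_nonpos (hd : 3 ≤ d) (hs : s = 1 ∨ s = -1) (hN : 1 ≤ N)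
    {x : Site d} (hx : x ∈ half s n) (hxN : x ∈ box d n N) :
    generator (finiteNbrs d n N (faces d n N)) (boxBarrier s n N) x ≤ 0 := by
  refine (generator_le_generator_of_subset (nbr' := latticeNbrs)
    (fun y hy => ((mem_finiteNbrs hxN).1 hy).1) fun y hy hy' => ?_).trans
    (generator_latticeNbrs_boxBarrier hd hs n N x)
  by_cases hyd : y ∈ domain d n
  · obtain ⟨i, a, ha, rfl⟩ := exists_single_of_mem_latticeNbrs hy
    have hi : i ≠ 0 := by
      rintro rfl
      exact hy' (mem_finiteNbrs_faces_of_single_zero hxN ha (mem_domainNbrs.2 ⟨hy, hyd⟩))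
    refine boxBarrier_le_lateral hs hN hi ha ?_
    have hyB : x + Pi.single i a ∉ box d n N := fun h =>
      hy' ((mem_finiteNbrs hxN).2 ⟨hy, Or.inl h⟩)
    have hxi := (mem_box.1 hxN).1 i
    by_contra hne
    refine hyB (mem_box.2 ⟨fun j => ?_, hyd⟩)
    by_cases hj : j = i
    · subst hj
      simp only [Pi.add_apply, Pi.single_eq_same]
      rw [abs_le] at hxi ⊢
      rcases ha with rfl | rfl <;> omega
    · simpa [hj] using (mem_box.1 hxN).1 j
  · obtain ⟨h1, rfl⟩ := exists_eq_reflect hs hx hy hyd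
    exact (boxBarrier_reflect hs N h1).ge

/-- Comparison of the Fick profile with its boundary value on one side. -/
lemma abs_lamFin_sub_le_boxBarrier (hd : 3 ≤ d) (hn : 1 ≤ n) (hs : s = 1 ∨ s = -1) (hN : 1 ≤ N)
    {σ : Site d → ℝ} {l m : ℝ} (hm : ∀ y ∈ faces d n N, |σ y - l| ≤ m)
    (hσ : ∀ y ∈ faces d n N, y ∈ half s n → σ y = l)
    {x : Site d} (hx : x ∈ half s n) (hc : x ∉ channel d n) (hxN : x ∈ box d n N) :
    |lamFin d n N (faces d n N) σ x - l| ≤ m * (mouthLevel d n)⁻¹ * boxBarrier s n N x := by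
  classical
  have hm0 : 0 ≤ m := (abs_nonneg _).trans (abs_lamFin_sub_le hm hxN)
  have hK : 0 ≤ m * (mouthLevel d n)⁻¹ := mul_nonneg hm0 (inv_nonneg.2 mouthLevel_pos.le)
  set K := m * (mouthLevel d n)⁻¹ with hKdef
  -- The walk leaves `B` either at the mouth, where the normalised barrier exceeds `1` and the
  -- global bound `m` is enough, or at the face of side `s`, where the difference vanishes.
  set B := (box d n N).filter fun x => x ∈ half s n ∧ x ∉ channel d n with hB
  have hmemB : ∀ {x}, x ∈ B ↔ x ∈ box d n N ∧ x ∈ half s n ∧ x ∉ channel d n := by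
    intro x; rw [hB, Finset.mem_filter]
  set u := lamFin d n N (faces d n N) σ with hu
  have hle1 : ∀ {y : Site d}, y ∈ box d n (N + 1) → s * y 0 ≤ N + 1 := by
    intro y hy
    have := (mem_box.1 hy).1 0
    rw [abs_le] at this
    push_cast at this
    rcases hs with rfl | rfl <;> omega
  have hbd : ∀ x ∈ B, ∀ y ∈ finiteNbrs d n N (faces d n N) x, y ∉ B →
      |u y - l| ≤ K * boxBarrier s n N y := by
    intro x hxB y hy hyB
    obtain ⟨hx1, hx2, hx3⟩ := hmemB.1 hxB
    have hyd := finiteNbrs_faces_subset hx1 hy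
    have hyh := mem_half_of_mem_domainNbrs hn hs hx2 hx3 hyd
    have hbar := barrier_le_boxBarrier hn hyh (hle1 (mem_box_succ_of_mem_domainNbrs hx1 hyd))
    rcases ((mem_finiteNbrs hx1).1 hy).2 with h | h
    · have hyc : y ∈ channel d n := by
        by_contra hyc
        exact hyB (hmemB.2 ⟨h, hyh, hyc⟩)
      refine (abs_lamFin_sub_le hm h).trans ?_
      have h1 := (mouthLevel_le_barrier hs hyh hyc).trans hbar
      have h2 := mul_le_mul_of_nonneg_left h1 hK
      rwa [hKdef, mul_assoc, inv_mul_cancel₀ mouthLevel_pos.ne', mul_one] at h2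
    · rw [hu, lamFin_of_mem σ h, hσ y h hyh, sub_self, abs_zero]
      exact mul_nonneg hK ((barrier_pos s n y).le.trans hbar)
  have hsub : ∀ c : ℝ, ∀ x ∈ B, 0 ≤ generator (finiteNbrs d n N (faces d n N))
      (fun y => c * (u y - l) - K * boxBarrier s n N y) x := by
    intro c x hxB
    obtain ⟨hx1, hx2, -⟩ := hmemB.1 hxB
    rw [generator_sub, generator_const_mul, generator_sub, generator_const, generator_const_mul,
      generator_lamFin_eq_zero faces_subset_shell]
    have := mul_nonpos_of_nonneg_of_nonpos hK (generator_boxBarrier_nonpos hd hs hN hx2 hx1)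
    linarith
  -- Taking `c = 1` and `c = -1` gives both halves of the absolute value.
  have main : ∀ c : ℝ, |c| ≤ 1 → c * (u x - l) - K * boxBarrier s n N x ≤ 0 := by
    intro c hc1
    refine le_of_subharmonic (finiteNbrs d n N (faces d n N)) B
      (fun y => c * (u y - l) - K * boxBarrier s n N y) 0 (depth n)
      (fun x hx => exists_depth_lt_faces (hmemB.1 hx).1) (hsub c) (fun x hx y hy hyB => ?_) x
      (hmemB.2 ⟨hxN, hx, hc⟩)
    have h1 := hbd x hx y hy hyB
    have h2 : c * (u y - l) ≤ |u y - l| := by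
      refine (le_abs_self _).trans ?_
      rw [abs_mul]
      exact mul_le_of_le_one_left (abs_nonneg _) hc1
    linarith
  have h1 := main 1 (by simp)
  have h2 := main (-1) (by simp)
  rw [abs_le]
  constructor <;> linarith

lemma barrier_le_of_mem_shell (hs : s = 1 ∨ s = -1) {R : ℕ} (hR : n ≤ R) {y : Site d}
    (hy : y ∈ shell d n R) (hys : y ∈ half s n) :
    barrier s n y ≤ decay (((R : ℝ) - n + 1) ^ 2) := by
  have hR' : (n : ℝ) ≤ R := by exact_mod_cast hR
  obtain ⟨h1, h2⟩ := mem_shell.1 hy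
  have hex : ∃ i, (R : ℤ) < |y i| := by
    by_contra! h
    exact h2 (mem_box.2 ⟨h, (mem_box.1 h1).2⟩)
  obtain ⟨i, hi⟩ := hex
  have hi' : (R : ℝ) + 1 ≤ |(y i : ℝ)| := by exact_mod_cast hi
  refine decay_le (by positivity) ?_
  have h3 : wallCoord s n y i ^ 2 ≤ ∑ j, wallCoord s n y j ^ 2 :=
    Finset.single_le_sum (f := fun j => wallCoord s n y j ^ 2) (fun _ _ => sq_nonneg _)
      (Finset.mem_univ i)
  have hn0 : (0 : ℝ) ≤ n := Nat.cast_nonneg n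
  have h4 : ((R : ℝ) - n + 1) ^ 2 ≤ wallCoord s n y i ^ 2 := by
    rw [← sq_abs (wallCoord s n y i)]
    refine pow_le_pow_left₀ (by linarith) ?_ 2
    unfold wallCoord
    split_ifs with h0
    · subst h0
      rw [mem_half] at hys
      have hys' : (n : ℝ) ≤ s * y 0 := by exact_mod_cast hys
      have : |(y 0 : ℝ)| = s * y 0 := by
        rcases hs with rfl | rfl
        · push_cast at hys' ⊢
          rw [abs_of_nonneg (by linarith)]; ring
        · push_cast at hys' ⊢
          rw [abs_of_nonpos (by linarith)]; ring
      refine le_trans ?_ (le_abs_self _)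
      linarith
    · linarith
  unfold mouthDist
  linarith

lemma notMem_channel_of_mem_shell {R : ℕ} (hR : n ≤ R) {y : Site d} (hy : y ∈ shell d n R) :
    y ∉ channel d n := by
  intro hc
  obtain ⟨h1, h2⟩ := mem_shell.1 hy
  exact h2 (mem_box.2 ⟨fun i => (hc i).trans (by exact_mod_cast hR), (mem_box.1 h1).2⟩)

/-- In the box of size `R` both functions are harmonic for the same walk. On its shell each is
compared with the value of the side; the first error depends only on `R`, and the second is the
lateral correction, which vanishes as `N → ∞`. -/
lemma abs_lamFin_sub_lam_le (hd : 3 ≤ d) (hn : 1 ≤ n) {lm lp : ℝ} {R : ℕ} (hR : n ≤ R)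
    (hRN : R < N) {σ : Site d → ℝ} (hp : ∀ y ∈ rightFace d n N, σ y = lp)
    (hm : ∀ y ∈ leftFace d n N, σ y = lm) {x : Site d} (hx : x ∈ box d n R) :
    |lamFin d n N (faces d n N) σ x - lam d n lm lp x| ≤
      (|lp - lm| + |lm| + |lp|) * (mouthLevel d n)⁻¹ * decay (((R : ℝ) - n + 1) ^ 2) +
        |lp - lm| * (mouthLevel d n)⁻¹ * (8 * d) * decay ((N : ℝ) ^ 2) := by
  have hN : 1 ≤ N := by omega
  have hM : 0 ≤ (mouthLevel d n)⁻¹ := inv_nonneg.2 mouthLevel_pos.le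
  refine abs_le_of_harmonic_box
    (u := fun x => lamFin d n N (faces d n N) σ x - lam d n lm lp x) (fun x hx => ?_)
    (fun y hy => ?_) x hx
  · rw [generator_sub, generator_lam, sub_zero,
      ← generator_congr (finiteNbrs_eq_domainNbrs hRN faces_subset_shell hx),
      generator_lamFin_eq_zero faces_subset_shell]
  · have hyc := notMem_channel_of_mem_shell hR hy
    have hyN : y ∈ box d n N := box_mono hRN (mem_shell.1 hy).1
    have hex : ∃ s : ℤ, (s = 1 ∨ s = -1) ∧ y ∈ half s n := by
      rcases exists_mem_half (mem_box.1 hyN).2 hyc with h | h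
      exacts [⟨1, Or.inl rfl, h⟩, ⟨-1, Or.inr rfl, h⟩]
    obtain ⟨s, hs, hys⟩ := hex
    have hσ1 : ∀ z ∈ faces d n N, |σ z - sideValue lm lp s| ≤ |lp - lm| := by
      intro z hz
      rcases Finset.mem_union.1 hz with h | h
      · rw [hp z h]
        rcases hs with rfl | rfl <;> simp [sideValue]
      · rw [hm z h]
        rcases hs with rfl | rfl <;> simp [sideValue, abs_sub_comm]
    have hσ2 : ∀ z ∈ faces d n N, z ∈ half s n → σ z = sideValue lm lp s := by
      intro z hz hzs
      rw [mem_half] at hzs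
      rcases Finset.mem_union.1 hz with h | h
      · have h0 := apply_zero_of_mem_rightFace h
        rcases hs with rfl | rfl
        · simp [sideValue, hp z h]
        · omega
      · have h0 := apply_zero_of_mem_leftFace h
        rcases hs with rfl | rfl
        · omega
        · simp [sideValue, hm z h]
    have h1 := abs_lamFin_sub_le_boxBarrier hd hn hs hN hσ1 hσ2 hys hyc hyN
    have h2 := abs_lam_sub_le hd hn hs lm lp hys
    have h3 := boxBarrier_le hn hs hN hys hyN
    have h4 := barrier_le_of_mem_shell hs hR hy hys
    have h5 := mul_le_mul_of_nonneg_left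
      (h3.trans (add_le_add_left h4 _)) (mul_nonneg (abs_nonneg (lp - lm)) hM)
    have h6 := mul_le_mul_of_nonneg_left (mul_le_mul_of_nonneg_left h4 hM)
      (add_nonneg (abs_nonneg lm) (abs_nonneg lp))
    have h7 := abs_sub_le (lamFin d n N (faces d n N) σ y) (sideValue lm lp s) (lam d n lm lp y)
    rw [abs_sub_comm (sideValue lm lp s)] at h7
    linarith

lemma tendsto_decay_sq_sub (c : ℝ) :
    Tendsto (fun N : ℕ => decay (((N : ℝ) - c) ^ 2)) atTop (𝓝 0) :=
  tendsto_decay.comp ((tendsto_pow_atTop two_ne_zero).comp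
    (tendsto_atTop_add_const_right _ (-c) tendsto_natCast_atTop_atTop))

/-- Convergence in the Fick setting. -/
lemma tendsto_lamFin_faces (hd : 3 ≤ d) (hn : 1 ≤ n) {lm lp : ℝ} {σ : ℕ → Site d → ℝ}
    (hσ : ∀ N, n < N → (∀ y ∈ rightFace d n N, σ N y = lp) ∧ ∀ y ∈ leftFace d n N, σ N y = lm)
    {x : Site d} (hx : x ∈ domain d n) :
    Tendsto (fun N => lamFin d n N (faces d n N) (σ N) x) atTop (𝓝 (lam d n lm lp x)) := by
  rw [Metric.tendsto_atTop']
  intro ε hε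
  have hR : Tendsto (fun R : ℕ => (|lp - lm| + |lm| + |lp|) * (mouthLevel d n)⁻¹ *
      decay (((R : ℝ) - (n - 1)) ^ 2)) atTop (𝓝 0) := by
    simpa using (tendsto_decay_sq_sub (n - 1)).const_mul
      ((|lp - lm| + |lm| + |lp|) * (mouthLevel d n)⁻¹)
  have hN : Tendsto (fun N : ℕ => |lp - lm| * (mouthLevel d n)⁻¹ * (8 * d) *
      decay ((N : ℝ) ^ 2)) atTop (𝓝 0) := by
    simpa using (tendsto_decay_sq_sub 0).const_mul (|lp - lm| * (mouthLevel d n)⁻¹ * (8 * d))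
  -- `R` is fixed before `N`: large enough for the first error term and for the box to contain both
  -- the channel and `x`.
  obtain ⟨R, hR1, hR2, hR3⟩ := ((hR.eventually (gt_mem_nhds (half_pos hε))).and
    ((eventually_ge_atTop n).and
      (eventually_ge_atTop (Finset.univ.sup fun i => (x i).natAbs)))).exists
  have hxR : x ∈ box d n R := by
    refine mem_box.2 ⟨fun i => ?_, hx⟩
    have : (x i).natAbs ≤ R :=
      (Finset.le_sup (f := fun i => (x i).natAbs) (Finset.mem_univ i)).trans hR3
    rw [Int.abs_eq_natAbs]
    omega
  obtain ⟨N₀, hN₀⟩ := eventually_atTop.1 (hN.eventually (gt_mem_nhds (half_pos hε)))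
  refine ⟨max N₀ R, fun N hNR => ?_⟩
  have h1 : R < N := (le_max_right _ _).trans_lt hNR
  have h2 := hN₀ N ((le_max_left _ _).trans hNR.le)
  obtain ⟨hp, hm⟩ := hσ N (by omega)
  rw [Real.dist_eq]
  have h3 := abs_lamFin_sub_lam_le hd hn hR2 h1 hp hm hxR
  rw [show (R : ℝ) - (n - 1) = R - n + 1 by ring] at hR1
  linarith

end Fick

end FickWalk

theorem mainTheorem7 (d : ℕ) [NeZero d] (n : ℕ) (hn : 1 ≤ n) (lm lp : ℝ) (hl : lm < lp) :
    -- harmonicity, with boundary values `σ` on `Δ`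
    (∀ (N : ℕ) (Δ : Finset (FickWalk.Site d)), Δ ⊆ FickWalk.shell d n N →
      ∀ σ : FickWalk.Site d → ℝ,
        (∀ x ∈ FickWalk.box d n N ∪ Δ,
          FickWalk.generator (FickWalk.finiteNbrs d n N Δ) (FickWalk.lamFin d n N Δ σ) x = 0) ∧
        (∀ x ∈ Δ, FickWalk.lamFin d n N Δ σ x = σ x)) ∧
    -- the Fick setting
    (3 ≤ d → ∀ σ : ℕ → FickWalk.Site d → ℝ,
      (∀ N, n < N → (∀ y ∈ FickWalk.rightFace d n N, σ N y = lp) ∧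
        (∀ y ∈ FickWalk.leftFace d n N, σ N y = lm)) →
      ∀ x ∈ FickWalk.domain d n,
        Tendsto (fun N => FickWalk.lamFin d n N
          (FickWalk.rightFace d n N ∪ FickWalk.leftFace d n N) (σ N) x) atTop
          (𝓝 (FickWalk.lam d n lm lp x))) ∧
    -- the full setting
    (∀ (N : ℕ) (σ : FickWalk.Site d → ℝ),
      (∀ y ∈ FickWalk.shell d n N, σ y = FickWalk.lam d n lm lp y) →
      ∀ x ∈ FickWalk.box d n N,
        FickWalk.lamFin d n N (FickWalk.shell d n N) σ x = FickWalk.lam d n lm lp x) :=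
  ⟨fun _ _ hΔ σ => ⟨fun x _ => FickWalk.generator_lamFin_eq_zero hΔ σ x,
      fun _ hx => FickWalk.lamFin_of_mem σ hx⟩,
    fun hd _ hσ _ hx => FickWalk.tendsto_lamFin_faces hd hn hσ hx,
    fun _ _ hσ _ hx => FickWalk.lamFin_shell_eq_lam hσ hx⟩
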